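/- Let $d\ge 2$ and let $X\subset\mathbb{P}^4_{\mathbb{C}}$ be a smooth hypersurface of degree $d$. Let $b_1\ge b_2\ge 1$ be integers and let $l\in\mathbb{Z}$. Write $T_X^*$ for the cotangent bundle of $X$ and $\mathcal{O}(l)$ for the restriction to $X$ of the $l$-th power of the hyperplane line bundle. Let $\Gamma^{(b_1,b_2,0)}$ be the Schur functor: for a vector space $V$, $\Gamma^{(a_1,a_2,a_3)}V\subset S^{a_1}V\otimes S^{a_2}V\otimes S^{a_3}V$ is the space of polynomials $P(x_1,x_2,x_3)$ on $(V^*)^3$, homogeneous of degree $a_j$ in $x_j$ for each $j$, which are invariant under every substitution $x_j\mapsto x_j+x_k$ with $k<j$; it is applied fibrewise to vector bundles. If $l<b_1+b_2$, then $$H^0\bigl(X,\ \Gamma^{(b_1,b_2,0)}T_X^*\otimes\mathcal{O}(l)\bigr)=0.$$ -/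

import Mathlib

open scoped KaehlerDifferential

noncomputable section

/-! ### Schur functors of a module -/

section Schur

variable (A : Type) [CommRing A] (M : Type) [AddCommGroup M] [Module A M] (r : ℕ)

/-- Polynomials `P(x₁, …, x_r)` in `r` variables `x_j` running through the dual of `M`, that is, the
symmetric algebra of `M ^ r`. An `m : M`, regarded as the linear form `x_j ↦ m(x_j)` in the `j`-th
variable, is `linForm A M r j m`. -/
abbrev PolyAlg : Type := SymmetricAlgebra A (Fin r → M)

/-- The linear form `P(x₁, …, x_r) = m(x_j)`. -/
def linForm (j : Fin r) : M →ₗ[A] PolyAlg A M r :=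
  SymmetricAlgebra.ι A (Fin r → M) ∘ₗ LinearMap.single A (fun _ : Fin r => M) j

/-- The polynomials that are homogeneous of degree `a j` in `x_j` for every `j`, that is,
`S^{a₁} M ⊗ ⋯ ⊗ S^{a_r} M` inside the symmetric algebra of `M ^ r`. -/
def multiHomogeneous (a : Fin r → ℕ) : Submodule A (PolyAlg A M r) :=
  ∏ j, LinearMap.range (linForm A M r j) ^ a j

/-- The substitution `P ↦ P(x₁, …, x_{j-1}, x_j + x_k, x_{j+1}, …, x_r)`. It sends the linear form
`m(x_j)` to `m(x_j) + m(x_k)` and fixes `m(x_i)` for `i ≠ j`. -/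
def unipotentSubst (j k : Fin r) : PolyAlg A M r →ₐ[A] PolyAlg A M r :=
  SymmetricAlgebra.lift (SymmetricAlgebra.ι A (Fin r → M) ∘ₗ
    (LinearMap.id + LinearMap.single A (fun _ : Fin r => M) k ∘ₗ LinearMap.proj j))

/-- The Schur functor `Γ^{(a₁, …, a_r)} M`: the polynomials `P(x₁, …, x_r)` on `(M^*)^r`,
homogeneous of degree `a_j` in `x_j`, which are invariant under all the substitutions
`x_j ↦ x_j + x_k` with `k < j`. -/
def schur (a : Fin r → ℕ) : Submodule A (PolyAlg A M r) :=
  multiHomogeneous A M r a ⊓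
    ⨅ (j : Fin r) (k : Fin r) (_ : k < j),
      LinearMap.eqLocus (unipotentSubst A M r j k).toLinearMap LinearMap.id

end Schur

/-! ### Pull-back of polynomials in differential forms along a homomorphism of algebras -/

section Pullback

variable {A B : Type} [CommRing A] [CommRing B]

/-- The ring homomorphism of symmetric algebras induced by a semilinear map. -/
def symPullback (f : A →+* B) {M N : Type} [AddCommGroup M] [Module A M] [AddCommGroup N]
    [Module B N] (φ : M →ₛₗ[f] N) : SymmetricAlgebra A M →+* SymmetricAlgebra B N :=
  letI : Algebra A (SymmetricAlgebra B N) :=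
    ((algebraMap B (SymmetricAlgebra B N)).comp f).toAlgebra
  (SymmetricAlgebra.lift (R := A) (M := M) (A := SymmetricAlgebra B N)
    { toFun := fun m => SymmetricAlgebra.ι B N (φ m)
      map_add' := fun m m' => by simp
      map_smul' := fun c m => by
        rw [LinearMap.map_smulₛₗ, map_smul, Algebra.smul_def, Algebra.smul_def]
        rfl }).toRingHom

theorem symPullback_algebraMap (f : A →+* B) {M N : Type} [AddCommGroup M] [Module A M]
    [AddCommGroup N] [Module B N] (φ : M →ₛₗ[f] N) (c : A) :
    symPullback f φ (algebraMap A _ c) = algebraMap B _ (f c) := by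
  let : Algebra A (SymmetricAlgebra B N) :=
    ((algebraMap B (SymmetricAlgebra B N)).comp f).toAlgebra
  exact AlgHom.commutes (SymmetricAlgebra.lift (R := A) (M := M) (A := SymmetricAlgebra B N) _) c

theorem symPullback_ι (f : A →+* B) {M N : Type} [AddCommGroup M] [Module A M]
    [AddCommGroup N] [Module B N] (φ : M →ₛₗ[f] N) (m : M) :
    symPullback f φ (SymmetricAlgebra.ι A M m) = SymmetricAlgebra.ι B N (φ m) := by
  let : Algebra A (SymmetricAlgebra B N) :=
    ((algebraMap B (SymmetricAlgebra B N)).comp f).toAlgebra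
  exact SymmetricAlgebra.lift_ι_apply _ m

variable {K : Type} [CommRing K] [Algebra K A] [Algebra K B]

/-- Pull-back of differential forms: `c • D a ↦ f c • D (f a)`. -/
def kaehlerPullback (f : A →ₐ[K] B) : Ω[A⁄K] →ₛₗ[f.toRingHom] Ω[B⁄K] :=
  letI : Algebra A B := f.toRingHom.toAlgebra
  haveI : IsScalarTower K A B := IsScalarTower.of_algebraMap_eq fun c => (f.commutes c).symm
  { toFun := KaehlerDifferential.map K K A B
    map_add' := fun x y => map_add _ x y
    map_smul' := fun c x => by
      rw [map_smul, ← algebraMap_smul B c]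
      rfl }

theorem kaehlerPullback_D (f : A →ₐ[K] B) (a : A) :
    kaehlerPullback f (KaehlerDifferential.D K A a) = KaehlerDifferential.D K B (f a) := by
  let : Algebra A B := f.toRingHom.toAlgebra
  have : IsScalarTower K A B := IsScalarTower.of_algebraMap_eq fun c => (f.commutes c).symm
  exact KaehlerDifferential.map_D K K A B a

/-- Pull-back along `f` of polynomials in differential forms, so that a local section of the Schur
power of the cotangent sheaf over `Spec A` is pulled back to `Spec B`. -/
def formPullback (r : ℕ) (f : A →ₐ[K] B) : PolyAlg A Ω[A⁄K] r →+* PolyAlg B Ω[B⁄K] r :=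
  symPullback f.toRingHom
    { toFun := fun u j => kaehlerPullback f (u j)
      map_add' := fun u v => by
        funext j
        exact (kaehlerPullback f).map_add (u j) (v j)
      map_smul' := fun c u => by
        funext j
        exact (kaehlerPullback f).map_smulₛₗ c (u j) }

theorem formPullback_linForm (r : ℕ) (f : A →ₐ[K] B) (j : Fin r) (ω : Ω[A⁄K]) :
    formPullback r f (linForm A Ω[A⁄K] r j ω) =
      linForm B Ω[B⁄K] r j (kaehlerPullback f ω) := by
  simp only [formPullback, linForm, LinearMap.comp_apply, symPullback_ι]
  congr 1
  funext i
  by_cases h : i = j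
  · subst h
    change kaehlerPullback f ((Pi.single i ω : Fin r → Ω[A⁄K]) i) =
      (Pi.single i (kaehlerPullback f ω) : Fin r → Ω[B⁄K]) i
    rw [Pi.single_eq_same, Pi.single_eq_same]
  · change kaehlerPullback f ((Pi.single j ω : Fin r → Ω[A⁄K]) i) =
      (Pi.single j (kaehlerPullback f ω) : Fin r → Ω[B⁄K]) i
    rw [Pi.single_eq_of_ne h, Pi.single_eq_of_ne h, map_zero]

end Pullback

/-! ### Smooth hypersurfaces in complex projective 4-space -/

/-- A smooth hypersurface of degree `d` in `ℙ⁴` over `ℂ`: the zero locus of a homogeneous polynomial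
of degree `d` whose gradient has no zero on it. -/
structure SmoothHypersurface (d : ℕ) where
  /-- the homogeneous equation -/
  F : MvPolynomial (Fin 5) ℂ
  homogeneous : F.IsHomogeneous d
  smooth : ∀ x : Fin 5 → ℂ, x ≠ 0 → MvPolynomial.eval x F = 0 →
    ∃ i, MvPolynomial.eval x (MvPolynomial.pderiv i F) ≠ 0

namespace SmoothHypersurface

variable {d : ℕ} (X : SmoothHypersurface d)

/-- The coordinate ring of the standard affine open subset `U_i = {x_i ≠ 0}` of `X`, normalised by
`x_i = 1`. -/
abbrev Chart (i : Fin 5) : Type :=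
  MvPolynomial (Fin 5) ℂ ⧸ Ideal.span {X.F, MvPolynomial.X i - 1}

/-- The affine coordinate `x_k / x_i` on `U_i`. -/
def coord (i k : Fin 5) : X.Chart i := Ideal.Quotient.mk _ (MvPolynomial.X k)

/-- The coordinate ring of `U_i ∩ U_j`, as the open subset `x_j / x_i ≠ 0` of `U_i`. -/
abbrev Overlap (i j : Fin 5) : Type := Localization.Away (X.coord i j)

/-- Restriction of functions from `U_i` to `U_i ∩ U_j`. -/
def res (i j : Fin 5) : X.Chart i →ₐ[ℂ] X.Overlap i j :=
  IsScalarTower.toAlgHom ℂ (X.Chart i) (X.Overlap i j)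

/-- The function `x_j / x_i`, invertible on `U_i ∩ U_j`. -/
def ratio (i j : Fin 5) : (X.Overlap i j)ˣ :=
  (IsLocalization.Away.algebraMap_isUnit (S := X.Overlap i j) (X.coord i j)).unit

/-- The coordinates `x_k / x_j = (x_k / x_i) (x_j / x_i)⁻¹` of `U_j`, as functions on `U_i ∩ U_j`. -/
def coordChange (i j k : Fin 5) : X.Overlap i j :=
  X.res i j (X.coord i k) * ((X.ratio i j)⁻¹ : (X.Overlap i j)ˣ)

theorem aeval_coordChange (i j : Fin 5) (p : MvPolynomial (Fin 5) ℂ)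
    (hp : p ∈ Ideal.span {X.F, MvPolynomial.X j - 1}) :
    MvPolynomial.aeval (X.coordChange i j) p = 0 := by
  have h : Ideal.span {X.F, MvPolynomial.X j - 1} ≤
      RingHom.ker (MvPolynomial.aeval (R := ℂ) (X.coordChange i j)) := by
    rw [Ideal.span_le]
    rintro q (rfl | rfl)
    · have hsm : X.coordChange i j =
          (((X.ratio i j)⁻¹ : (X.Overlap i j)ˣ) : X.Overlap i j) •
            fun k => X.res i j (X.coord i k) := by
        funext k
        simp only [coordChange, Pi.smul_apply, smul_eq_mul]
        ring
      have h0 : MvPolynomial.aeval (fun k => X.res i j (X.coord i k)) X.F = 0 := by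
        have h1 : (MvPolynomial.aeval (fun k => X.res i j (X.coord i k)) :
            MvPolynomial (Fin 5) ℂ →ₐ[ℂ] X.Overlap i j) =
            (X.res i j).comp (Ideal.Quotient.mkₐ ℂ _) := by
          ext k
          simp [coord]
        rw [h1, AlgHom.comp_apply]
        have h2 : Ideal.Quotient.mkₐ ℂ (Ideal.span {X.F, MvPolynomial.X i - 1}) X.F = 0 :=
          Ideal.Quotient.eq_zero_iff_mem.mpr (Ideal.subset_span (by simp))
        rw [h2, map_zero]
      have h3 : MvPolynomial.aeval (X.coordChange i j) X.F =
          (((X.ratio i j)⁻¹ : (X.Overlap i j)ˣ) : X.Overlap i j) ^ d *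
            MvPolynomial.aeval (fun k => X.res i j (X.coord i k)) X.F := by
        rw [hsm, MvPolynomial.aeval_def, MvPolynomial.aeval_def, MvPolynomial.eval₂_eq',
          MvPolynomial.eval₂_eq', Finset.mul_sum]
        refine Finset.sum_congr rfl fun m hm => ?_
        have hd : ∑ k, m k = d := by
          have h4 := X.homogeneous (MvPolynomial.mem_support_iff.mp hm)
          rw [Finsupp.weight_apply, Finsupp.sum_fintype _ _ (by simp)] at h4
          simpa using h4
        simp only [Pi.smul_apply, smul_eq_mul, mul_pow, Finset.prod_mul_distrib]
        rw [Finset.prod_pow_eq_pow_sum, hd]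
        ring
      simp only [SetLike.mem_coe, RingHom.mem_ker]
      rw [h3, h0, mul_zero]
    · simp only [SetLike.mem_coe, RingHom.mem_ker, map_sub, MvPolynomial.aeval_X, map_one]
      have : X.res i j (X.coord i j) = (X.ratio i j : X.Overlap i j) := rfl
      rw [coordChange, this, Units.mul_inv, sub_self]
  exact h hp

/-- Restriction of functions from `U_j` to `U_i ∩ U_j`. -/
def trans (i j : Fin 5) : X.Chart j →ₐ[ℂ] X.Overlap i j :=
  Ideal.Quotient.liftₐ _ (MvPolynomial.aeval (X.coordChange i j)) (X.aeval_coordChange i j)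

/-- The group `H⁰(X, Γ^{(a₁, …, a_r)} T_X^* ⊗ 𝒪(l))` of global sections. A section is given on
`U_i` by `ω_i ⊗ x_i ^ l`, with `ω_i` in the Schur power of the module of Kähler differentials of the
coordinate ring of `U_i`, and these have to agree on all `U_i ∩ U_j`, that is,
`ω_i = (x_j / x_i) ^ l • ω_j` there. -/
def globalSections {r : ℕ} (a : Fin r → ℕ) (l : ℤ) :
    AddSubgroup ((i : Fin 5) → schur (X.Chart i) Ω[X.Chart i⁄ℂ] r a) where
  carrier := {ω | ∀ i j, formPullback r (X.res i j) (ω i) =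
    ((X.ratio i j ^ l : (X.Overlap i j)ˣ) : X.Overlap i j) • formPullback r (X.trans i j) (ω j)}
  zero_mem' := fun i j => by simp
  add_mem' := fun {ω η} hω hη i j => by
    have h1 := hω i j
    have h2 := hη i j
    simp only [Pi.add_apply, Submodule.coe_add, map_add, smul_add, h1, h2]
  neg_mem' := fun {ω} hω i j => by
    have h1 := hω i j
    simp only [Pi.neg_apply, Submodule.coe_neg, map_neg, smul_neg, h1]

end SmoothHypersurface

end

/-! A section is a form of degree b₁ + b₂ in two tangent vectors, twisted by 𝒪(l). Pull it back to
the affine cone: for F(x) = 0 and vectors v₁, v₂ killed by the gradient of F at x, the quantity xᵢ^l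
ωᵢ(v₁, v₂) does not depend on the chart (`PairPoint.value_eq_value`). So ω becomes a function on the
open part x ≠ 0 of the scheme Z of triples (x, v₁, v₂), cut out of 𝔸¹⁵ by three equations.

This function extends over x = 0 because the ideal of that locus has grade at least 2 on Z. The
powers xᵢ^N have grade 5 on ℂ[x], and each of the three equations lowers the grade by at most one.
The tangency equations are regular because, by smoothness and the Nullstellensatz, the xᵢ^N lie in
the gradient ideal (`exists_gradeGE`). The extension s is provided by `exists_value_eq`.

Replacing x by t x with v fixed scales the induced vectors on X by t⁻¹, so s(t x, v) = t^(l - b₁ -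
b₂) s(x, v) wherever some xᵢ and t are invertible. The left side is polynomial in t and the exponent
is negative, so s(x, v) = 0 there (`PairPoint.value_eq_zero`). Evaluation at the tautological
vectors of Uᵢ recovers ωᵢ, which therefore vanishes.

Grade is measured by generic linear combinations with adjoined variables, so McCoy's theorem
replaces arguments with associated primes. -/

noncomputable section
-- Grade of a sequence via generic linear combinations
namespace GenericDepth
open MvPolynomial

/-- The generic linear combination of the elements `x i`. -/
def linearForm {ι : Type} [Fintype ι] {R : Type} [CommRing R] (x : ι → R) : MvPolynomial ι R :=
  ∑ i, C (x i) * X i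

/-- The shift X i ↦ X i + T ^ (e i + 1) is injective, being split by T = 0, and makes each `p i` the
coefficient of its own positive power of T. McCoy's theorem in the single variable T then only asks
about elements killed by every `p i`, which is checked on coefficients. -/
theorem linearForm_regular_bot {ι : Type} [Fintype ι] {R : Type} [CommRing R] (p : ι → R)
    (h : ∀ r : R, (∀ i, p i * r = 0) → r = 0) (q : MvPolynomial ι R)
    (hq : linearForm p * q = 0) : q = 0 := by
  classical
  let e := (Fintype.equivFin ι)
  let τ : MvPolynomial ι R →ₐ[R] Polynomial (MvPolynomial ι R) :=
    aeval fun i => Polynomial.C (X i) + Polynomial.X ^ ((e i : ℕ) + 1)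
  let ρ : Polynomial (MvPolynomial ι R) →ₐ[R] MvPolynomial ι R :=
    (Polynomial.aeval (0 : MvPolynomial ι R)).restrictScalars R
  have hρ : ∀ u, ρ (τ u) = u := by
    have : ρ.comp τ = AlgHom.id R _ := by
      ext i
      simp [ρ, τ]
    exact fun u => DFunLike.congr_fun this u
  have hτ : τ (linearForm p) = Polynomial.C (linearForm p) +
      ∑ i, Polynomial.C (C (p i)) * Polynomial.X ^ ((e i : ℕ) + 1) := by
    simp only [linearForm, map_sum, map_mul, τ, aeval_X, algHom_C, mul_add, Finset.sum_add_distrib]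
    rfl
  have hreg : τ (linearForm p) ∈ nonZeroDivisors (Polynomial (MvPolynomial ι R)) := by
    rw [Polynomial.mem_nonZeroDivisors_iff]
    intro a ha
    ext m
    rw [coeff_zero]
    refine h _ fun i => ?_
    have h1 := congrArg (fun f => Polynomial.coeff f ((e i : ℕ) + 1)) ha
    simp only [hτ, Polynomial.coeff_smul, Polynomial.coeff_add, Polynomial.coeff_C_succ, zero_add,
      Polynomial.finsetSum_coeff, Polynomial.coeff_C_mul, Polynomial.coeff_X_pow,
      Polynomial.coeff_zero, smul_eq_mul] at h1
    rw [Finset.sum_eq_single i] at h1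
    · have h2 := congrArg (coeff m) h1
      simpa [mul_comm _ (C _), coeff_C_mul] using h2
    · intro j _ hj
      rw [if_neg, mul_zero]
      intro h3
      exact hj (e.injective (Fin.ext (by omega)))
    · simp
  have h0 : τ q = 0 := by
    refine (mem_nonZeroDivisors_iff.mp hreg).1 _ ?_
    rw [← map_mul, hq, map_zero]
  rw [← hρ q, h0, map_zero]

/-- McCoy's theorem for linear forms. -/
theorem linearForm_regular {ι : Type} [Fintype ι] {R : Type} [CommRing R] (I : Ideal R)
    (p : ι → R) (h : ∀ r : R, (∀ i, p i * r ∈ I) → r ∈ I) (q : MvPolynomial ι R)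
    (hq : linearForm p * q ∈ I.map C) : q ∈ I.map C := by
  have key : ∀ u : MvPolynomial ι R,
      u ∈ I.map (C : R →+* MvPolynomial ι R) ↔ map (Ideal.Quotient.mk I) u = 0 := by
    intro u
    rw [mem_map_C_iff, MvPolynomial.ext_iff]
    simp [coeff_map, Ideal.Quotient.eq_zero_iff_mem]
  rw [key] at hq ⊢
  refine linearForm_regular_bot (fun i => Ideal.Quotient.mk I (p i)) ?_ _ ?_
  · intro r hr
    obtain ⟨r, rfl⟩ := Ideal.Quotient.mk_surjective r
    rw [Ideal.Quotient.eq_zero_iff_mem]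
    refine h r fun i => ?_
    rw [← Ideal.Quotient.eq_zero_iff_mem, map_mul, hr i]
  · rw [← hq, map_mul]
    simp [linearForm]

/-- The sequence `x` has grade at least `n` on `R ⧸ I`: `n` generic linear combinations of the `x i`
form a regular sequence. -/
def GradeGE {ι : Type} [Fintype ι] : ℕ → ∀ (R : Type) [CommRing R], Ideal R → (ι → R) → Prop
  | 0, _, _, _, _ => True
  | n + 1, R, _, I, x => (∀ r, (∀ i, x i * r ∈ I) → r ∈ I) ∧
      GradeGE n (MvPolynomial ι R) (I.map C ⊔ Ideal.span {linearForm x}) fun i => C (x i)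

section

variable {ι : Type} [Fintype ι]

theorem mem_sup_span_singleton {R : Type} [CommRing R] {I : Ideal R} {f r : R} :
    r ∈ I ⊔ Ideal.span {f} ↔ ∃ c, r - f * c ∈ I := by
  constructor
  · intro h
    obtain ⟨y, hy, z, hz, rfl⟩ := Submodule.mem_sup.mp h
    obtain ⟨c, rfl⟩ := Ideal.mem_span_singleton.mp hz
    exact ⟨c, by simpa using hy⟩
  · rintro ⟨c, hc⟩
    have : r = (r - f * c) + f * c := by ring
    rw [this]
    exact add_mem (Ideal.mem_sup_left hc)
      (Ideal.mem_sup_right (Ideal.mul_mem_right _ _ (Ideal.mem_span_singleton_self f)))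

theorem C_mem_map_C {κ R : Type} [CommRing R] {I : Ideal R} {r : R} :
    (C r : MvPolynomial κ R) ∈ I.map C ↔ r ∈ I := by
  classical
  constructor
  · intro h
    simpa using mem_map_C_iff.mp h 0
  · exact Ideal.mem_map_of_mem C

theorem C_mul_regular {κ R : Type} [CommRing R] {I : Ideal R} {f : R}
    (hf : ∀ r, f * r ∈ I → r ∈ I) (q : MvPolynomial κ R) (hq : C f * q ∈ I.map C) :
    q ∈ I.map C := by
  rw [mem_map_C_iff] at hq ⊢
  intro m
  exact hf _ (by simpa [coeff_C_mul] using hq m)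

theorem map_C_sup_span {κ R : Type} [CommRing R] (I : Ideal R) (f : R) :
    (I ⊔ Ideal.span {f}).map (C : R →+* MvPolynomial κ R) =
      I.map C ⊔ Ideal.span {C f} := by
  rw [Ideal.map_sup, Ideal.map_span, Set.image_singleton]

/-- If `f` is regular modulo `I` and `g` is regular modulo `I + (f)`, then `f` is regular modulo
`I + (g)`. -/
theorem regular_swap {R : Type} [CommRing R] {I : Ideal R} {f g : R}
    (hf : ∀ r, f * r ∈ I → r ∈ I)
    (hgf : ∀ r, g * r ∈ I ⊔ Ideal.span {f} → r ∈ I ⊔ Ideal.span {f})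
    (r : R) (hr : f * r ∈ I ⊔ Ideal.span {g}) : r ∈ I ⊔ Ideal.span {g} := by
  obtain ⟨w, hw⟩ := mem_sup_span_singleton.mp hr
  have h1 : g * w ∈ I ⊔ Ideal.span {f} := by
    refine mem_sup_span_singleton.mpr ⟨r, ?_⟩
    rw [← neg_mem_iff]
    simpa using hw
  obtain ⟨w', hw'⟩ := mem_sup_span_singleton.mp (hgf w h1)
  refine mem_sup_span_singleton.mpr ⟨w', hf _ ?_⟩
  have : f * (r - g * w') = (f * r - g * w) + g * (w - f * w') := by ring
  rw [this]
  exact add_mem hw (Ideal.mul_mem_left _ _ hw')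

/-- Dividing by a regular element lowers the grade by at most one. -/
theorem GradeGE.mod_regular (n : ℕ) : ∀ {R : Type} [CommRing R] {I : Ideal R} {x : ι → R},
    GradeGE (n + 1) R I x → ∀ f : R, (∀ r, f * r ∈ I → r ∈ I) →
    GradeGE n R (I ⊔ Ideal.span {f}) x := by
  induction n with
  | zero => intros; trivial
  | succ n ih =>
    intro R _ I x h f hf
    have hG := linearForm_regular I x h.1
    have h1 : ∀ r, (∀ i, x i * r ∈ I ⊔ Ideal.span {f}) → r ∈ I ⊔ Ideal.span {f} := by
      intro r hr
      choose m hm using fun i => mem_sup_span_singleton.mp (hr i)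
      -- Modulo I, x i * r = f * m i, so ℓ r = f u for ℓ = `linearForm x`. Cancelling f from f (x i
      -- * u) = f (ℓ * m i) shows that u dies modulo ℓ by the second grade condition; writing u = ℓ
      -- w and cancelling ℓ gives r = f w.
      set u : MvPolynomial ι R := ∑ i, C (m i) * X i with hu
      have e1 : linearForm x * C r - C f * u ∈ I.map (C : R →+* MvPolynomial ι R) := by
        have : linearForm x * C r - C f * u = ∑ i, X i * C (x i * r - f * m i) := by
          simp only [linearForm, hu, Finset.sum_mul, Finset.mul_sum, ← Finset.sum_sub_distrib,
            map_sub, map_mul]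
          exact Finset.sum_congr rfl fun i _ => by ring
        rw [this]
        exact sum_mem fun i _ => Ideal.mul_mem_left _ _ (C_mem_map_C.mpr (hm i))
      have e2 : u ∈ I.map C ⊔ Ideal.span {linearForm x} := by
        refine h.2.1 _ fun i => mem_sup_span_singleton.mpr ⟨C (m i), C_mul_regular hf _ ?_⟩
        have : C f * (C (x i) * u - linearForm x * C (m i)) =
            linearForm x * C (x i * r - f * m i) - C (x i) * (linearForm x * C r - C f * u) := by
          simp only [map_sub, map_mul]; ring
        rw [this]
        exact sub_mem (Ideal.mul_mem_left _ _ (C_mem_map_C.mpr (hm i))) (Ideal.mul_mem_left _ _ e1)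
      obtain ⟨w, hw⟩ := mem_sup_span_singleton.mp e2
      have e3 : C r - C f * w ∈ I.map (C : R →+* MvPolynomial ι R) := by
        refine hG _ ?_
        have : linearForm x * (C r - C f * w) =
            (linearForm x * C r - C f * u) + C f * (u - linearForm x * w) := by ring
        rw [this]
        exact add_mem e1 (Ideal.mul_mem_left _ _ hw)
      refine mem_sup_span_singleton.mpr ⟨coeff 0 w, ?_⟩
      classical
      simpa [coeff_C_mul] using mem_map_C_iff.mp e3 0
    refine ⟨h1, ?_⟩
    rw [map_C_sup_span, sup_right_comm]
    -- By the condition just proved and McCoy, ℓ is regular modulo f, so f and ℓ may be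
    -- interchanged.
    refine ih h.2 _ (regular_swap (C_mul_regular hf) ?_)
    rw [← map_C_sup_span]
    exact linearForm_regular _ x h1

theorem mul_mem_of_mem_span_range {κ R : Type} [CommRing R] {I : Ideal R} {p : κ → R} {f r : R}
    (hf : f ∈ Ideal.span (Set.range p)) (hr : ∀ i, p i * r ∈ I) : f * r ∈ I := by
  have : Ideal.span (Set.range p) ≤ I.colon {r} := by
    rw [Ideal.span_le]
    rintro _ ⟨i, rfl⟩
    simpa [Submodule.mem_colon_singleton] using hr i
  simpa [Submodule.mem_colon_singleton] using this hf

/-- If `f` is a regular element of the ideal of the `x i`, then the grade is greater than that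
modulo `f`. -/
theorem GradeGE.of_mod (n : ℕ) : ∀ {R : Type} [CommRing R] {I : Ideal R} {x : ι → R} (f : R),
    (∀ r, f * r ∈ I → r ∈ I) → f ∈ Ideal.span (Set.range x) →
    GradeGE n R (I ⊔ Ideal.span {f}) x → GradeGE (n + 1) R I x := by
  induction n with
  | zero =>
    intro R _ I x f hf hfx _
    exact ⟨fun r hr => hf r (mul_mem_of_mem_span_range hfx hr), trivial⟩
  | succ n ih =>
    intro R _ I x f hf hfx h
    have h0 : ∀ r, (∀ i, x i * r ∈ I) → r ∈ I := fun r hr =>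
      hf r (mul_mem_of_mem_span_range hfx hr)
    -- The induction runs modulo ℓ, where f stays regular because ℓ is regular modulo f.
    refine ⟨h0, ih (C f) (regular_swap (C_mul_regular hf) ?_) ?_ ?_⟩
    · rw [← map_C_sup_span]
      exact linearForm_regular _ x h.1
    · have := Ideal.mem_map_of_mem (C : R →+* MvPolynomial ι R) hfx
      rw [Ideal.map_span, ← Set.range_comp] at this
      exact this
    · have := h.2
      rwa [map_C_sup_span, sup_right_comm] at this

theorem GradeGE.map_equiv (n : ℕ) : ∀ {R R' : Type} [CommRing R] [CommRing R'] (e : R ≃+* R')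
    {I : Ideal R} {x : ι → R}, GradeGE n R I x →
    GradeGE n R' (I.map e.toRingHom) fun i => e (x i) := by
  induction n with
  | zero => intros; trivial
  | succ n ih =>
    intro R R' _ _ e I x h
    have hmem : ∀ r, e r ∈ I.map e.toRingHom ↔ r ∈ I := fun r => by
      constructor
      · intro hr
        obtain ⟨s, hs, hs'⟩ := (Ideal.mem_map_iff_of_surjective e.toRingHom e.surjective).mp hr
        rwa [← e.injective hs']
      · exact Ideal.mem_map_of_mem e.toRingHom
    refine ⟨fun r hr => ?_, ?_⟩
    · obtain ⟨r, rfl⟩ := e.surjective r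
      rw [hmem]
      refine h.1 r fun i => ?_
      rw [← hmem, map_mul]
      exact hr i
    · have := ih (mapEquiv ι e) h.2
      convert this using 1
      · rw [Ideal.map_sup, Ideal.map_map, Ideal.map_map, Ideal.map_span, Set.image_singleton]
        congr 2
        · ext : 1; simp
        · simp [linearForm]
      · funext i; simp

theorem GradeGE.polynomial (κ : Type) (n : ℕ) : ∀ {R : Type} [CommRing R] {I : Ideal R}
    {x : ι → R}, GradeGE n R I x →
    GradeGE n (MvPolynomial κ R) (I.map C) fun i => C (x i) := by
  induction n with
  | zero => intros; trivial
  | succ n ih =>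
    intro R _ I x h
    refine ⟨fun r hr => ?_, ?_⟩
    · rw [mem_map_C_iff]
      refine fun m => h.1 _ fun i => ?_
      simpa [coeff_C_mul] using mem_map_C_iff.mp (hr i) m
    · have := GradeGE.map_equiv n (commAlgEquiv R κ ι).toRingEquiv (ih h.2)
      convert this using 1
      · rw [map_C_sup_span, Ideal.map_sup, Ideal.map_map, Ideal.map_map, Ideal.map_map,
          Ideal.map_span, Set.image_singleton]
        congr 2
        · ext : 1
          simp
        · simp [linearForm]
      · funext i; simp

/-- This is the vanishing of the first Koszul cohomology in grade two. The generic combination u of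
the `b i` satisfies x j * u = ℓ * b j modulo I, hence u = ℓ c by the second condition, and
cancelling ℓ leaves b j = x j * c. -/
theorem GradeGE.exists_eq_mul {R : Type} [CommRing R] {I : Ideal R} {x : ι → R}
    (h : GradeGE 2 R I x) (b : ι → R) (hb : ∀ i j, x j * b i - x i * b j ∈ I) :
    ∃ c, ∀ i, b i - x i * c ∈ I := by
  have hG := linearForm_regular I x h.1
  set u : MvPolynomial ι R := linearForm b with hu
  have e1 : ∀ j, C (x j) * u - linearForm x * C (b j) ∈ I.map (C : R →+* MvPolynomial ι R) := by
    intro j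
    have : C (x j) * u - linearForm x * C (b j) = ∑ i, X i * C (x j * b i - x i * b j) := by
      simp only [linearForm, hu, Finset.sum_mul, Finset.mul_sum, ← Finset.sum_sub_distrib,
        map_sub, map_mul]
      exact Finset.sum_congr rfl fun i _ => by ring
    rw [this]
    exact sum_mem fun i _ => Ideal.mul_mem_left _ _ (C_mem_map_C.mpr (hb i j))
  obtain ⟨c, hc⟩ := mem_sup_span_singleton.mp
    (h.2.1 u fun j => mem_sup_span_singleton.mpr ⟨_, e1 j⟩)
  refine ⟨coeff 0 c, fun j => ?_⟩
  have e3 : C (b j) - C (x j) * c ∈ I.map (C : R →+* MvPolynomial ι R) := by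
    refine hG _ ?_
    have : linearForm x * (C (b j) - C (x j) * c) =
        C (x j) * (u - linearForm x * c) - (C (x j) * u - linearForm x * C (b j)) := by ring
    rw [this]
    exact sub_mem (Ideal.mul_mem_left _ _ hc) (e1 j)
  classical
  simpa [coeff_C_mul] using mem_map_C_iff.mp e3 0

end

end GenericDepth

/-! ### Grade of powers of the variables -/

namespace GenericDepth
open MvPolynomial

/-- For a monomial ideal, membership is tested on each monomial, and multiplying by a power of X k
does not affect the exponents of variables in s. -/
theorem X_pow_mul_mem {σ K : Type} [Field K] {N : ℕ} {s : Set σ} {k : σ} (hk : k ∉ s)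
    (q : MvPolynomial σ K)
    (hq : X k ^ N * q ∈ Ideal.span ((fun j : σ => (X j ^ N : MvPolynomial σ K)) '' s)) :
    q ∈ Ideal.span ((fun j : σ => (X j ^ N : MvPolynomial σ K)) '' s) := by
  classical
  have himg : (fun j : σ => (X j ^ N : MvPolynomial σ K)) '' s =
      (fun m => monomial m (1 : K)) '' ((fun j => Finsupp.single j N) '' s) := by
    rw [Set.image_image]
    simp only [X_pow_eq_monomial]
  rw [himg, mem_ideal_span_monomial_image] at hq ⊢
  intro m hm
  have h1 : Finsupp.single k N + m ∈ (X k ^ N * q).support := by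
    rw [mem_support_iff, X_pow_eq_monomial, coeff_monomial_mul, one_mul]
    exact mem_support_iff.mp hm
  obtain ⟨_, ⟨j, hj, rfl⟩, hle⟩ := hq _ h1
  refine ⟨_, ⟨j, hj, rfl⟩, ?_⟩
  rw [Finsupp.single_le_iff] at hle ⊢
  have hne : k ≠ j := fun e => hk (e ▸ hj)
  simpa [Finsupp.single_apply, hne] using hle

theorem gradeGE_X_pow {K : Type} [Field K] (n N : ℕ) :
    GradeGE n (MvPolynomial (Fin n) K) ⊥ fun i => X i ^ N := by
  -- Descend from the quotient by all the powers, adding one unit of grade each time the last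
  -- remaining power is dropped; at m = n the ideal is zero.
  suffices h : ∀ m, m ≤ n → GradeGE m (MvPolynomial (Fin n) K)
      (Ideal.span ((fun j : Fin n => (X j ^ N : MvPolynomial (Fin n) K)) '' {j | j + m < n}))
      fun i => X i ^ N by
    have h1 := h n le_rfl
    simpa using h1
  intro m
  induction m with
  | zero => intro _; trivial
  | succ m ih =>
    intro hm
    let k : Fin n := ⟨n - (m + 1), by omega⟩
    refine GradeGE.of_mod m (X k ^ N) ?_ (Ideal.subset_span ⟨k, rfl⟩) ?_
    · exact X_pow_mul_mem (by simp [k]; omega)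
    · have hs : {j : Fin n | (j : ℕ) + m < n} = insert k {j : Fin n | (j : ℕ) + (m + 1) < n} := by
        ext j
        simp only [Set.mem_ofPred_eq, Set.mem_insert_iff, Fin.ext_iff, k]
        omega
      have h1 := ih (by omega)
      rw [hs, Set.image_insert_eq, Ideal.span_insert, sup_comm] at h1
      exact h1

/-- If each `x i` lies in the ideal of the `p j`, then the generic linear combination of the `p j` is
regular on quotients on which `x` has positive grade. -/
theorem GradeGE.adjoin_linearForm {ι κ : Type} [Fintype ι] [Fintype κ] {n : ℕ} {R : Type}
    [CommRing R] {I : Ideal R} {x : ι → R} (h : GradeGE (n + 1) R I x) (p : κ → R)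
    (hp : ∀ i, x i ∈ Ideal.span (Set.range p)) :
    GradeGE n (MvPolynomial κ R) (I.map C ⊔ Ideal.span {linearForm p}) fun i => C (x i) := by
  refine GradeGE.mod_regular _ (GradeGE.polynomial κ _ h) _ (linearForm_regular I p ?_)
  exact fun r hr => h.1 r fun i => mul_mem_of_mem_span_range (hp i) hr

end GenericDepth

/-! ### The cone with two tangent vectors and its grade along the vertex -/

namespace SmoothHypersurface
open MvPolynomial GenericDepth

variable {d : ℕ} (X : SmoothHypersurface d)

/-- The partial derivatives of the equation. -/
def grad (i : Fin 5) : MvPolynomial (Fin 5) ℂ := pderiv i X.F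

/-- Polynomials in the coordinates of a point and of one vector. -/
def TangentRing : Type := MvPolynomial (Fin 5) (MvPolynomial (Fin 5) ℂ)

instance : CommRing TangentRing :=
  inferInstanceAs (CommRing (MvPolynomial (Fin 5) (MvPolynomial (Fin 5) ℂ)))

instance : Algebra ℂ TangentRing :=
  inferInstanceAs (Algebra ℂ (MvPolynomial (Fin 5) (MvPolynomial (Fin 5) ℂ)))

/-- Polynomials in the coordinates of a point, as polynomials on pairs of a point and a vector. -/
def TangentRing.base : MvPolynomial (Fin 5) ℂ →+* TangentRing := MvPolynomial.C

/-- The coordinates of the vector. -/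
def TangentRing.vec (i : Fin 5) : TangentRing :=
  (MvPolynomial.X i : MvPolynomial (Fin 5) (MvPolynomial (Fin 5) ℂ))

/-- The ideal of the cone over `X` with one tangent vector. -/
def tangentIdeal : Ideal TangentRing :=
  (Ideal.span {X.F}).map TangentRing.base ⊔
    Ideal.span {∑ i, TangentRing.base (X.grad i) * TangentRing.vec i}

/-- The ideal of the cone over `X` with two tangent vectors. -/
def tangentPairIdeal : Ideal (MvPolynomial (Fin 5) TangentRing) :=
  X.tangentIdeal.map C ⊔ Ideal.span {linearForm fun i => TangentRing.base (X.grad i)}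

theorem F_ne_zero : X.F ≠ 0 := by
  intro h
  obtain ⟨i, hi⟩ := X.smooth 1 one_ne_zero (by simp [h])
  exact hi (by simp [h])

/-- Euler's relation. -/
theorem sum_X_mul_grad : ∑ i, MvPolynomial.X i * X.grad i = d • X.F := by
  exact X.homogeneous.sum_X_mul_pderiv

/-- A common zero of the gradient is a zero of F by Euler's relation, as d ≠ 0, and is then the
origin by smoothness. The Nullstellensatz turns this into powers of the variables. -/
theorem exists_X_pow_mem_span_grad (hd : d ≠ 0) :
    ∃ M, ∀ i, (MvPolynomial.X i : MvPolynomial (Fin 5) ℂ) ^ M ∈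
      Ideal.span (Set.range X.grad) := by
  have h : ∀ i, ∃ M, (MvPolynomial.X i : MvPolynomial (Fin 5) ℂ) ^ M ∈
      Ideal.span (Set.range X.grad) := by
    intro i
    change MvPolynomial.X i ∈ (Ideal.span (Set.range X.grad)).radical
    rw [← vanishingIdeal_zeroLocus_eq_radical (K := ℂ), mem_vanishingIdeal_iff]
    intro x hx
    by_contra hne
    have hx0 : x ≠ 0 := fun h0 => hne (by simp [h0])
    have hgrad : ∀ j, eval x (X.grad j) = 0 := fun j => by
      have := hx _ (Ideal.subset_span ⟨j, rfl⟩)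
      simpa [aeval_eq_eval] using this
    have hF : eval x X.F = 0 := by
      have h1 := congrArg (eval x) X.sum_X_mul_grad
      simpa [hgrad, hd] using h1
    obtain ⟨j, hj⟩ := X.smooth x hx0 hF
    exact hj (hgrad j)
  choose M hM using h
  refine ⟨∑ i, M i, fun i => ?_⟩
  exact Ideal.mem_of_dvd _ (pow_dvd_pow _ (Finset.single_le_sum (fun _ _ => Nat.zero_le _)
    (Finset.mem_univ i))) (hM i)

/-- The grade drops from 5 to 4 modulo F, and then by one for each tangency equation. All large
exponents are allowed, so that denominators can be cleared later. -/
theorem exists_gradeGE (hd : d ≠ 0) : ∃ M, ∀ N, M ≤ N →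
    GradeGE 2 _ X.tangentPairIdeal fun i => C (TangentRing.base (MvPolynomial.X i ^ N)) := by
  obtain ⟨M, hM⟩ := X.exists_X_pow_mem_span_grad hd
  refine ⟨M, fun N hN => ?_⟩
  have hp : ∀ i, (MvPolynomial.X i : MvPolynomial (Fin 5) ℂ) ^ N ∈
      Ideal.span (Set.range X.grad) := fun i => Ideal.mem_of_dvd _ (pow_dvd_pow _ hN) (hM i)
  have h0 : GradeGE 4 (MvPolynomial (Fin 5) ℂ) (Ideal.span {X.F}) fun i => MvPolynomial.X i ^ N := by
    have := GradeGE.mod_regular 4 (gradeGE_X_pow (K := ℂ) 5 N) X.F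
      (fun r hr => by simpa [X.F_ne_zero] using hr)
    simpa using this
  have h1 : GradeGE 3 TangentRing X.tangentIdeal fun i => TangentRing.base (MvPolynomial.X i ^ N) :=
    h0.adjoin_linearForm X.grad hp
  refine h1.adjoin_linearForm (fun i => TangentRing.base (X.grad i)) fun i => ?_
  have := Ideal.mem_map_of_mem TangentRing.base (hp i)
  rw [Ideal.map_span, ← Set.range_comp] at this
  exact this

/-- The coordinate ring of the cone over `X` with two tangent vectors. -/
abbrev TangentPairs : Type :=
  MvPolynomial (Fin 5) TangentRing ⧸ X.tangentPairIdeal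

/-- The coordinates of the base point of a pair of tangent vectors. -/
def basePoint (i : Fin 5) : X.TangentPairs :=
  Ideal.Quotient.mk _ (C (TangentRing.base (MvPolynomial.X i)))

/-- The coordinates of the two tangent vectors. -/
def tangentVector : Fin 2 → Fin 5 → X.TangentPairs :=
  ![fun i => Ideal.Quotient.mk _ (C (TangentRing.vec i)),
    fun i => Ideal.Quotient.mk _ (MvPolynomial.X i)]

/-- Functions on the punctured cone extend over the vertex. -/
theorem exists_eq_basePoint_pow_mul (hd : d ≠ 0) (N : ℕ) (a : Fin 5 → X.TangentPairs)
    (ha : ∀ i j, X.basePoint j ^ N * a i = X.basePoint i ^ N * a j) :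
    ∃ M s, ∀ i, X.basePoint i ^ M * a i = X.basePoint i ^ (M + N) * s := by
  obtain ⟨M, hM⟩ := X.exists_gradeGE hd
  -- The grade is known only for exponents at least M, so the compatibility with exponent N is
  -- multiplied by (xᵢ xⱼ)^M.
  have h := hM (M + N) (by omega)
  choose b hb using fun i => Ideal.Quotient.mk_surjective (X.basePoint i ^ M * a i)
  have hx : ∀ i, Ideal.Quotient.mk X.tangentPairIdeal
      (C (TangentRing.base (MvPolynomial.X i ^ (M + N)))) =
      X.basePoint i ^ (M + N) := fun i => by simp [basePoint]
  obtain ⟨c, hc⟩ := h.exists_eq_mul b fun i j => by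
    rw [← Ideal.Quotient.eq_zero_iff_mem, map_sub, map_mul, map_mul, hx, hx, hb, hb]
    linear_combination X.basePoint i ^ M * X.basePoint j ^ M * ha i j
  refine ⟨M, Ideal.Quotient.mk _ c, fun i => ?_⟩
  have := hc i
  rw [← Ideal.Quotient.eq_zero_iff_mem, map_sub, map_mul, hx, hb] at this
  exact sub_eq_zero.mp this

end SmoothHypersurface

/-! ### Evaluation of polynomials in differential forms at tangent vectors -/

/-- Two ring homomorphisms out of polynomials in differential forms agree if they agree on
functions and on exact forms. -/
theorem PolyAlg.ringHom_ext {K A T : Type} [CommRing K] [CommRing A] [CommRing T] [Algebra K A]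
    {r : ℕ} {φ ψ : PolyAlg A Ω[A⁄K] r →+* T}
    (h₀ : ∀ a, φ (algebraMap A _ a) = ψ (algebraMap A _ a))
    (h₁ : ∀ j a, φ (linForm A Ω[A⁄K] r j (KaehlerDifferential.D K A a)) =
      ψ (linForm A Ω[A⁄K] r j (KaehlerDifferential.D K A a))) : φ = ψ := by
  have h₂ : ∀ j ω, φ (linForm A Ω[A⁄K] r j ω) = ψ (linForm A Ω[A⁄K] r j ω) := by
    intro j ω
    have : ω ∈ Submodule.span A (Set.range (KaehlerDifferential.D K A)) := by
      rw [KaehlerDifferential.span_range_derivation]; trivial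
    induction this using Submodule.span_induction with
    | mem x hx => obtain ⟨a, rfl⟩ := hx; exact h₁ j a
    | zero => simp
    | add x y _ _ hx hy => rw [map_add, map_add, map_add, hx, hy]
    | smul a x _ hx =>
      rw [map_smul, Algebra.smul_def, map_mul, map_mul, hx, h₀]
  refine RingHom.ext fun P => ?_
  induction P using SymmetricAlgebra.induction with
  | algebraMap a => exact h₀ a
  | ι u =>
    have : SymmetricAlgebra.ι A (Fin r → Ω[A⁄K]) u = ∑ j, linForm A Ω[A⁄K] r j (u j) := by
      simp only [linForm, LinearMap.comp_apply, ← map_sum, LinearMap.single_apply]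
      rw [Finset.univ_sum_single]
    rw [this, map_sum, map_sum]
    exact Finset.sum_congr rfl fun j _ => h₂ j _
  | mul P Q hP hQ => rw [map_mul, map_mul, hP, hQ]
  | add P Q hP hQ => rw [map_add, map_add, hP, hQ]

section TangentTuples

open scoped DualNumber
open TrivSqZeroExt

variable {K A A' T T' : Type} [CommRing K] [CommRing A] [CommRing A'] [CommRing T] [CommRing T']
  [Algebra K A] [Algebra K A'] [Algebra K T] [Algebra K T'] {r : ℕ}

/-- The homomorphism `a + b ε ↦ g a + c * g b ε` of dual numbers. -/
def dualMap (g : T →ₐ[K] T') (c : T') : T[ε] →ₐ[K] T'[ε] :=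
  DualNumber.lift ⟨((inlAlgHom K T' T').comp g, inr c), by simp, fun a => mul_comm _ _⟩

@[simp]
theorem fst_dualMap (g : T →ₐ[K] T') (c : T') (z : T[ε]) : (dualMap g c z).fst = g z.fst := by
  simp [dualMap, DualNumber.lift_apply_apply]

@[simp]
theorem snd_dualMap (g : T →ₐ[K] T') (c : T') (z : T[ε]) :
    (dualMap g c z).snd = c * g z.snd := by
  simp [dualMap, DualNumber.lift_apply_apply, mul_comm]

variable (K A T r) in
/-- An `r`-tuple of tangent vectors with values in `T` at a common `T`-valued point of `Spec A`. -/
structure TangentTuple where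
  /-- the point -/
  base : A →ₐ[K] T
  /-- the tangent vectors -/
  vel : Fin r → A →ₐ[K] T[ε]
  fst_vel : ∀ j a, (vel j a).fst = base a

namespace TangentTuple

/-- The image of a tuple of tangent vectors under a morphism of schemes. -/
def comp (τ : TangentTuple K A T r) (f : A' →ₐ[K] A) : TangentTuple K A' T r where
  base := τ.base.comp f
  vel j := (τ.vel j).comp f
  fst_vel j a := τ.fst_vel j (f a)

/-- Change of the ring of values, together with a scaling of the tangent vectors. -/
def map (τ : TangentTuple K A T r) (g : T →ₐ[K] T') (c : T') : TangentTuple K A T' r where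
  base := g.comp τ.base
  vel j := (dualMap g c).comp (τ.vel j)
  fst_vel j a := by simp [τ.fst_vel]

/-- Evaluation of polynomials in differential forms at a tuple of tangent vectors. -/
def evalForms (τ : TangentTuple K A T r) : PolyAlg A Ω[A⁄K] r →+* T :=
  letI : Algebra A T := τ.base.toRingHom.toAlgebra
  haveI : IsScalarTower K A T := IsScalarTower.of_algebraMap_eq fun c => (τ.base.commutes c).symm
  (SymmetricAlgebra.lift (∑ j, (Derivation.mk' ((sndHom T T).restrictScalars K ∘ₗ
      (τ.vel j).toLinearMap) fun a b => by
        simp only [LinearMap.comp_apply, LinearMap.restrictScalars_apply, sndHom_apply,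
          AlgHom.toLinearMap_apply, map_mul, DualNumber.snd_mul, τ.fst_vel]
        rw [mul_comm (τ.vel j a).snd]
        rfl).liftKaehlerDifferential ∘ₗ LinearMap.proj j)).toRingHom

theorem evalForms_algebraMap (τ : TangentTuple K A T r) (a : A) :
    τ.evalForms (algebraMap A _ a) = τ.base a := by
  let : Algebra A T := τ.base.toRingHom.toAlgebra
  exact AlgHom.commutes (SymmetricAlgebra.lift (R := A) (M := Fin r → Ω[A⁄K]) (A := T) _) a

theorem evalForms_smul (τ : TangentTuple K A T r) (a : A) (P : PolyAlg A Ω[A⁄K] r) :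
    τ.evalForms (a • P) = τ.base a * τ.evalForms P := by
  rw [Algebra.smul_def, map_mul, evalForms_algebraMap]

theorem evalForms_linForm_D (τ : TangentTuple K A T r) (j : Fin r) (a : A) :
    τ.evalForms (linForm A Ω[A⁄K] r j (KaehlerDifferential.D K A a)) = (τ.vel j a).snd := by
  let : Algebra A T := τ.base.toRingHom.toAlgebra
  have : IsScalarTower K A T := IsScalarTower.of_algebraMap_eq fun c => (τ.base.commutes c).symm
  refine (SymmetricAlgebra.lift_ι_apply _ _).trans ?_
  simp only [LinearMap.sum_apply, LinearMap.comp_apply, LinearMap.proj_apply,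
    LinearMap.single_apply]
  rw [Finset.sum_eq_single j]
  · rw [Pi.single_eq_same, Derivation.liftKaehlerDifferential_comp_D]
    rfl
  · intro i _ hi
    rw [Pi.single_eq_of_ne hi, map_zero]
  · simp

/-- The chain rule: evaluating a pulled-back form equals evaluating the form on the pushed-forward
vectors. Functions and exact forms suffice. -/
theorem evalForms_formPullback (τ : TangentTuple K A T r) (f : A' →ₐ[K] A)
    (P : PolyAlg A' Ω[A'⁄K] r) :
    τ.evalForms (formPullback r f P) = (τ.comp f).evalForms P := by
  refine DFunLike.congr_fun (PolyAlg.ringHom_ext (φ := τ.evalForms.comp (formPullback r f))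
    (fun a => ?_) fun j a => ?_) P
  · rw [RingHom.comp_apply, formPullback, symPullback_algebraMap, evalForms_algebraMap,
      evalForms_algebraMap]
    rfl
  · rw [RingHom.comp_apply, formPullback_linForm, kaehlerPullback_D, evalForms_linForm_D,
      evalForms_linForm_D]
    rfl

theorem map_evalForms (τ : TangentTuple K A T r) (g : T →ₐ[K] T') (P : PolyAlg A Ω[A⁄K] r) :
    g (τ.evalForms P) = (τ.map g 1).evalForms P := by
  refine DFunLike.congr_fun (PolyAlg.ringHom_ext (φ := g.toRingHom.comp τ.evalForms)
    (fun a => ?_) fun j a => ?_) P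
  · simp [evalForms_algebraMap, map]
  · simp [evalForms_linForm_D, map]

/-- Scaling of the tangent vectors by `c` multiplies a polynomial of degree `n` by `c ^ n`. -/
theorem evalForms_map_of_mem (τ : TangentTuple K A T r) (g : T →ₐ[K] T') (c : T') (a : Fin r → ℕ)
    {P : PolyAlg A Ω[A⁄K] r} (hP : P ∈ multiHomogeneous A Ω[A⁄K] r a) :
    (τ.map g c).evalForms P = c ^ (∑ j, a j) * g (τ.evalForms P) := by
  -- The elements of weight n. They form an A-submodule because functions have weight zero, and
  -- weights add under products, so it suffices to place linear forms in weight one.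
  let W : ℕ → Submodule A (PolyAlg A Ω[A⁄K] r) := fun n =>
    { carrier := {P | (τ.map g c).evalForms P = c ^ n * g (τ.evalForms P)}
      zero_mem' := by simp
      add_mem' := fun {P Q} hP hQ => by
        simp only [Set.mem_ofPred_eq, map_add, mul_add] at hP hQ ⊢
        rw [hP, hQ]
      smul_mem' := fun b P hP => by
        simp only [Set.mem_ofPred_eq, evalForms_smul, map_mul] at hP ⊢
        rw [hP]
        change g (τ.base b) * _ = _
        ring }
  have hmul : ∀ m n, W m * W n ≤ W (m + n) := fun m n => by
    rw [Submodule.mul_le]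
    intro P hP Q hQ
    change _ = _ at hP
    change _ = _ at hQ
    change _ = _
    rw [map_mul, map_mul, map_mul, hP, hQ, pow_add]
    ring
  have hone : (1 : Submodule A (PolyAlg A Ω[A⁄K] r)) ≤ W 0 := by
    rw [Submodule.one_le]
    change _ = _
    simp
  have hlin : ∀ j, LinearMap.range (linForm A Ω[A⁄K] r j) ≤ W 1 := by
    intro j
    rw [LinearMap.range_eq_map, ← KaehlerDifferential.span_range_derivation K A,
      Submodule.map_span_le]
    rintro _ ⟨b, rfl⟩
    change _ = _
    rw [evalForms_linForm_D, evalForms_linForm_D, pow_one]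
    simp [map]
  have hpow : ∀ j n, LinearMap.range (linForm A Ω[A⁄K] r j) ^ n ≤ W n := by
    intro j n
    induction n with
    | zero => rw [pow_zero]; exact hone
    | succ n ih =>
      rw [pow_succ]
      exact (mul_le_mul' ih (hlin j)).trans (hmul n 1)
  have hprod : ∀ s : Finset (Fin r), ∏ j ∈ s, LinearMap.range (linForm A Ω[A⁄K] r j) ^ a j ≤
      W (∑ j ∈ s, a j) := by
    classical
    intro s
    induction s using Finset.induction_on with
    | empty => simpa using hone
    | insert j s hj ih =>
      rw [Finset.prod_insert hj, Finset.sum_insert hj]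
      exact (mul_le_mul' (hpow j _) ih).trans (hmul _ _)
  exact hprod Finset.univ hP

/-- A tuple of tangent vectors with values in polynomials in differential forms whose vectors are
tautological in the slots that occur in `P` evaluates `P` to itself. -/
theorem evalForms_eq_self (τ : TangentTuple K A (PolyAlg A Ω[A⁄K] r) r)
    (h₀ : ∀ b, τ.base b = algebraMap A _ b) (a : Fin r → ℕ)
    (h₁ : ∀ j, a j ≠ 0 → ∀ b, (τ.vel j b).snd =
      linForm A Ω[A⁄K] r j (KaehlerDifferential.D K A b))
    {P : PolyAlg A Ω[A⁄K] r} (hP : P ∈ multiHomogeneous A Ω[A⁄K] r a) :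
    τ.evalForms P = P := by
  let ψ : PolyAlg A Ω[A⁄K] r →ₐ[A] PolyAlg A Ω[A⁄K] r :=
    { τ.evalForms with
      commutes' := fun b => (τ.evalForms_algebraMap b).trans (h₀ b) }
  let E : Subalgebra A (PolyAlg A Ω[A⁄K] r) := AlgHom.equalizer ψ (AlgHom.id A _)
  suffices h : multiHomogeneous A Ω[A⁄K] r a ≤ Subalgebra.toSubmodule E from h hP
  have hEE : Subalgebra.toSubmodule E * Subalgebra.toSubmodule E ≤ Subalgebra.toSubmodule E := by
    rw [Submodule.mul_le]
    exact fun P hP Q hQ => E.mul_mem hP hQ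
  have hone : (1 : Submodule A (PolyAlg A Ω[A⁄K] r)) ≤ Subalgebra.toSubmodule E :=
    Submodule.one_le.mpr E.one_mem
  have hpow : ∀ j, LinearMap.range (linForm A Ω[A⁄K] r j) ^ a j ≤ Subalgebra.toSubmodule E := by
    intro j
    -- A slot of exponent zero contributes only scalars, so the vector there may be arbitrary.
    rcases eq_or_ne (a j) 0 with h | h
    · rw [h, pow_zero]; exact hone
    · have hlin : LinearMap.range (linForm A Ω[A⁄K] r j) ≤ Subalgebra.toSubmodule E := by
        rw [LinearMap.range_eq_map, ← KaehlerDifferential.span_range_derivation K A,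
          Submodule.map_span_le]
        rintro _ ⟨b, rfl⟩
        exact (τ.evalForms_linForm_D j b).trans (h₁ j h b)
      generalize a j = n
      induction n with
      | zero => rw [pow_zero]; exact hone
      | succ n ih =>
        rw [pow_succ]
        exact (mul_le_mul' ih hlin).trans hEE
  rw [multiHomogeneous]
  refine Finset.prod_induction _ (· ≤ Subalgebra.toSubmodule E)
    (fun U V hU hV => (mul_le_mul' hU hV).trans hEE) hone fun j _ => hpow j

end TangentTuple

end TangentTuples

/-! ### Points of the charts in homogeneous coordinates, and tangent vectors of the cone -/

namespace SmoothHypersurface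

open scoped DualNumber
open TrivSqZeroExt

variable {d : ℕ} (X : SmoothHypersurface d) {Q T T' : Type} [CommRing Q]
  [CommRing T] [CommRing T'] [Algebra ℂ Q] [Algebra ℂ T] [Algebra ℂ T']

theorem _root_.MvPolynomial.IsHomogeneous.aeval_smul {σ R S : Type} [CommRing R] [CommRing S]
    [Algebra R S] [Fintype σ] {p : MvPolynomial σ R} {n : ℕ} (hp : p.IsHomogeneous n) (c : S)
    (y : σ → S) : MvPolynomial.aeval (c • y) p = c ^ n * MvPolynomial.aeval y p := by
  rw [MvPolynomial.aeval_def, MvPolynomial.aeval_def, MvPolynomial.eval₂_eq',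
    MvPolynomial.eval₂_eq', Finset.mul_sum]
  refine Finset.sum_congr rfl fun m hm => ?_
  have hd : ∑ k, m k = n := by
    have h4 := hp (MvPolynomial.mem_support_iff.mp hm)
    rw [Finsupp.weight_apply, Finsupp.sum_fintype _ _ (by simp)] at h4
    simpa using h4
  simp only [Pi.smul_apply, smul_eq_mul, mul_pow, Finset.prod_mul_distrib]
  rw [Finset.prod_pow_eq_pow_sum, hd]
  ring

variable {X} in
theorem chart_algHom_ext {i : Fin 5} {f g : X.Chart i →ₐ[ℂ] Q}
    (h : ∀ k, f (X.coord i k) = g (X.coord i k)) : f = g := by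
  refine Ideal.Quotient.algHom_ext _ (MvPolynomial.algHom_ext fun k => h k)

variable {X} in
theorem overlap_algHom_ext {i j : Fin 5} {f g : X.Overlap i j →ₐ[ℂ] Q}
    (h : f.comp (X.res i j) = g.comp (X.res i j)) : f = g := by
  refine AlgHom.coe_ringHom_injective (IsLocalization.ringHom_ext (Submonoid.powers (X.coord i j))
    (RingHom.ext fun a => DFunLike.congr_fun h a))

/-- The `Q`-valued point of the standard affine open subset `U_i` with homogeneous coordinates
`y`. -/
def chartPoint (i : Fin 5) (y : Fin 5 → Q) (hF : MvPolynomial.aeval y X.F = 0)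
    (hu : IsUnit (y i)) : X.Chart i →ₐ[ℂ] Q :=
  Ideal.Quotient.liftₐ _ (MvPolynomial.aeval ((↑hu.unit⁻¹ : Q) • y)) fun p hp => by
    have h : Ideal.span {X.F, MvPolynomial.X i - 1} ≤
        RingHom.ker (MvPolynomial.aeval (R := ℂ) ((↑hu.unit⁻¹ : Q) • y)) := by
      rw [Ideal.span_le]
      rintro q (rfl | rfl)
      · simp only [SetLike.mem_coe, RingHom.mem_ker]
        rw [X.homogeneous.aeval_smul, hF, mul_zero]
      · simp
    exact h hp

theorem chartPoint_coord (i k : Fin 5) (y : Fin 5 → Q) (hF : MvPolynomial.aeval y X.F = 0)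
    (hu : IsUnit (y i)) : X.chartPoint i y hF hu (X.coord i k) = (↑hu.unit⁻¹ : Q) * y k := by
  refine (Ideal.Quotient.liftₐ_apply _ _ _ _).trans ?_
  refine (Ideal.Quotient.lift_mk _ _ _).trans ?_
  simp

theorem chartPoint_coord_mul (i k : Fin 5) (y : Fin 5 → Q) (hF : MvPolynomial.aeval y X.F = 0)
    (hu : IsUnit (y i)) : X.chartPoint i y hF hu (X.coord i k) * y i = y k := by
  rw [chartPoint_coord, mul_right_comm]
  simp

/-- A point of `U_i` is determined by its homogeneous coordinates. -/
theorem eq_chartPoint (i : Fin 5) (y : Fin 5 → Q) (hF : MvPolynomial.aeval y X.F = 0)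
    (hu : IsUnit (y i)) (f : X.Chart i →ₐ[ℂ] Q) (h : ∀ k, f (X.coord i k) * y i = y k) :
    f = X.chartPoint i y hF hu :=
  chart_algHom_ext fun k => hu.mul_right_cancel ((h k).trans (X.chartPoint_coord_mul ..).symm)

/-- The `Q`-valued point of `U_i ∩ U_j` with homogeneous coordinates `y`. -/
def overlapPoint (i j : Fin 5) (y : Fin 5 → Q) (hF : MvPolynomial.aeval y X.F = 0)
    (hi : IsUnit (y i)) (hj : IsUnit (y j)) : X.Overlap i j →ₐ[ℂ] Q :=
  IsLocalization.Away.liftAlgHom (X.coord i j) (f := X.chartPoint i y hF hi) <| by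
    rw [chartPoint_coord]
    exact (Units.isUnit _).mul hj

theorem overlapPoint_comp_res (i j : Fin 5) (y : Fin 5 → Q) (hF : MvPolynomial.aeval y X.F = 0)
    (hi : IsUnit (y i)) (hj : IsUnit (y j)) :
    (X.overlapPoint i j y hF hi hj).comp (X.res i j) = X.chartPoint i y hF hi :=
  AlgHom.ext fun a => IsLocalization.Away.lift_eq (g := (X.chartPoint i y hF hi).toRingHom)
    (X.coord i j) (by
      change IsUnit (X.chartPoint i y hF hi (X.coord i j))
      rw [chartPoint_coord]
      exact (Units.isUnit _).mul hj) a

theorem overlapPoint_ratio (i j : Fin 5) (y : Fin 5 → Q) (hF : MvPolynomial.aeval y X.F = 0)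
    (hi : IsUnit (y i)) (hj : IsUnit (y j)) :
    X.overlapPoint i j y hF hi hj (X.ratio i j) * y i = y j := by
  have h1 : (X.ratio i j : X.Overlap i j) = X.res i j (X.coord i j) := rfl
  rw [h1, ← AlgHom.comp_apply, overlapPoint_comp_res, chartPoint_coord_mul]

/-- The coordinate change preserves homogeneous coordinates, and these determine a point of U_j. -/
theorem overlapPoint_comp_trans (i j : Fin 5) (y : Fin 5 → Q) (hF : MvPolynomial.aeval y X.F = 0)
    (hi : IsUnit (y i)) (hj : IsUnit (y j)) :
    (X.overlapPoint i j y hF hi hj).comp (X.trans i j) = X.chartPoint j y hF hj := by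
  refine X.eq_chartPoint _ _ _ _ _ fun k => ?_
  have h1 : X.trans i j (X.coord j k) = X.coordChange i j k := by
    refine (Ideal.Quotient.liftₐ_apply _ _ _ _).trans ?_
    refine (Ideal.Quotient.lift_mk _ _ _).trans ?_
    simp
  have h2 : X.coordChange i j k * X.ratio i j = X.res i j (X.coord i k) := by
    rw [coordChange, Units.inv_mul_cancel_right]
  have h3 := congrArg (X.overlapPoint i j y hF hi hj) h2
  rw [map_mul, ← AlgHom.comp_apply, overlapPoint_comp_res] at h3
  rw [AlgHom.comp_apply, h1]
  have h4 := X.overlapPoint_ratio i j y hF hi hj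
  have h5 := X.chartPoint_coord_mul i k y hF hi
  rw [← h4, ← mul_assoc, h3, h5]

/-- First-order Taylor expansion: it identifies tangent vectors of the cone with its points over the
dual numbers. -/
theorem aeval_inl_add_inr (p : MvPolynomial (Fin 5) ℂ) (x v : Fin 5 → T) :
    MvPolynomial.aeval (fun i => (inl (x i) + inr (v i) : T[ε])) p =
      inl (MvPolynomial.aeval x p) +
        inr (∑ i, MvPolynomial.aeval x (MvPolynomial.pderiv i p) * v i) := by
  induction p using MvPolynomial.induction_on with
  | C a =>
    simp only [MvPolynomial.algHom_C, MvPolynomial.pderiv_C, map_zero, zero_mul,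
      Finset.sum_const_zero, inr_zero, add_zero]
    rfl
  | add p q hp hq =>
    rw [map_add, hp, hq]
    simp only [map_add, add_mul, Finset.sum_add_distrib, inl_add, inr_add]
    abel
  | mul_X p k hp =>
    rw [map_mul, hp, MvPolynomial.aeval_X]
    have h : ∑ i, MvPolynomial.aeval x (MvPolynomial.pderiv i (p * MvPolynomial.X k)) * v i =
        MvPolynomial.aeval x p * v k +
          (∑ i, MvPolynomial.aeval x (MvPolynomial.pderiv i p) * v i) * x k := by
      classical
      simp only [Derivation.leibniz, MvPolynomial.pderiv_X, smul_eq_mul, map_add, map_mul,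
        MvPolynomial.aeval_X, add_mul, Finset.sum_add_distrib, Finset.sum_mul, Pi.single_apply]
      congr 1
      · simp
      · exact Finset.sum_congr rfl fun i _ => by ring
    rw [h]
    refine TrivSqZeroExt.ext (by simp) ?_
    simp

/-- Two tangent vectors with values in `T` at a common `T`-valued point of the cone over `X`. -/
structure PairPoint (T : Type) [CommRing T] [Algebra ℂ T] where
  /-- the point -/
  x : Fin 5 → T
  /-- the vectors -/
  v : Fin 2 → Fin 5 → T
  aeval_F : MvPolynomial.aeval x X.F = 0
  tangent : ∀ j, ∑ i, MvPolynomial.aeval x (X.grad i) * v j i = 0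

namespace PairPoint

variable {X}

@[ext]
theorem ext {q q' : X.PairPoint T} (h : q.x = q'.x) (h' : q.v = q'.v) : q = q' := by
  cases q; cases q'; subst h; subst h'; rfl

/-- Change of the ring of values. -/
def map (q : X.PairPoint T) (g : T →ₐ[ℂ] T') : X.PairPoint T' where
  x i := g (q.x i)
  v j i := g (q.v j i)
  aeval_F := by
    rw [← MvPolynomial.comp_aeval_apply, q.aeval_F, map_zero]
  tangent j := by
    simp only [← MvPolynomial.comp_aeval_apply, ← map_mul, ← map_sum, q.tangent, map_zero]

/-- Scaling of the point. -/
def scale (q : X.PairPoint T) (c : T) : X.PairPoint T where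
  x := c • q.x
  v := q.v
  aeval_F := by rw [X.homogeneous.aeval_smul, q.aeval_F, mul_zero]
  tangent j := by
    have h : ∀ i, (X.grad i).IsHomogeneous (d - 1) := fun i => X.homogeneous.pderiv
    simp only [(h _).aeval_smul, mul_assoc, ← Finset.mul_sum, q.tangent, mul_zero]

/-- The vector in each of three slots, the last one being zero. -/
def vec (q : X.PairPoint T) : Fin 3 → Fin 5 → T := ![q.v 0, q.v 1, 0]

/-- The point of the tangent cone in each of the three slots. -/
def dualPoint (q : X.PairPoint T) (j : Fin 3) (i : Fin 5) : T[ε] := inl (q.x i) + inr (q.vec j i)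

theorem aeval_dualPoint (q : X.PairPoint T) (j : Fin 3) :
    MvPolynomial.aeval (q.dualPoint j) X.F = 0 := by
  have h : ∑ i, MvPolynomial.aeval q.x (X.grad i) * q.vec j i = 0 := by
    fin_cases j
    · exact q.tangent 0
    · exact q.tangent 1
    · simp [vec]
  refine (aeval_inl_add_inr X.F q.x (q.vec j)).trans ?_
  rw [q.aeval_F]
  refine Eq.trans ?_ (add_zero _)
  congr 1
  exact (congrArg inr h).trans (inr_zero _)

theorem isUnit_dualPoint (q : X.PairPoint T) (j : Fin 3) {i : Fin 5} (h : IsUnit (q.x i)) :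
    IsUnit (q.dualPoint j i) := by
  rw [isUnit_iff_isUnit_fst]
  simpa [dualPoint] using h

/-- The tangent vectors of `U_i` given by tangent vectors of the cone. -/
def toTuple (q : X.PairPoint T) (i : Fin 5) (h : IsUnit (q.x i)) :
    TangentTuple ℂ (X.Chart i) T 3 where
  base := X.chartPoint i q.x q.aeval_F h
  vel j := X.chartPoint i (q.dualPoint j) (q.aeval_dualPoint j) (q.isUnit_dualPoint j h)
  fst_vel j a := by
    refine DFunLike.congr_fun (f := (fstHom ℂ T T).comp (X.chartPoint i (q.dualPoint j)
      (q.aeval_dualPoint j) (q.isUnit_dualPoint j h))) (X.eq_chartPoint _ _ _ _ _ fun k => ?_) a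
    have := congrArg fst (X.chartPoint_coord_mul i k (q.dualPoint j) (q.aeval_dualPoint j)
      (q.isUnit_dualPoint j h))
    simpa [dualPoint] using this

/-- The tangent vectors of `U_i ∩ U_j` given by tangent vectors of the cone. -/
def toOverlapTuple (q : X.PairPoint T) (i j : Fin 5) (hi : IsUnit (q.x i)) (hj : IsUnit (q.x j)) :
    TangentTuple ℂ (X.Overlap i j) T 3 where
  base := X.overlapPoint i j q.x q.aeval_F hi hj
  vel k := X.overlapPoint i j (q.dualPoint k) (q.aeval_dualPoint k) (q.isUnit_dualPoint k hi)
    (q.isUnit_dualPoint k hj)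
  fst_vel k a := by
    refine DFunLike.congr_fun (f := (fstHom ℂ T T).comp (X.overlapPoint i j (q.dualPoint k)
      (q.aeval_dualPoint k) (q.isUnit_dualPoint k hi) (q.isUnit_dualPoint k hj)))
      (overlap_algHom_ext ?_) a
    rw [AlgHom.comp_assoc, overlapPoint_comp_res, overlapPoint_comp_res]
    exact AlgHom.ext ((q.toTuple i hi).fst_vel k)

theorem toOverlapTuple_comp_res (q : X.PairPoint T) (i j : Fin 5) (hi : IsUnit (q.x i))
    (hj : IsUnit (q.x j)) : (q.toOverlapTuple i j hi hj).comp (X.res i j) = q.toTuple i hi := by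
  simp only [TangentTuple.comp, toOverlapTuple, toTuple, overlapPoint_comp_res]

theorem toOverlapTuple_comp_trans (q : X.PairPoint T) (i j : Fin 5) (hi : IsUnit (q.x i))
    (hj : IsUnit (q.x j)) : (q.toOverlapTuple i j hi hj).comp (X.trans i j) = q.toTuple j hj := by
  simp only [TangentTuple.comp, toOverlapTuple, toTuple, overlapPoint_comp_trans]

/-- Replacing the point `x` by a multiple `t x` of its image under `g` and keeping the vectors
amounts to scaling the induced vectors on `X` by `t⁻¹`. -/
theorem toTuple_eq_map (q : X.PairPoint T) (q' : X.PairPoint T') (g : T →ₐ[ℂ] T') (t : T'ˣ)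
    (hx : ∀ i, q'.x i = t * g (q.x i)) (hv : ∀ j i, q'.v j i = g (q.v j i)) (i : Fin 5)
    (h : IsUnit (q.x i)) (h' : IsUnit (q'.x i)) :
    q'.toTuple i h' = (q.toTuple i h).map g (t⁻¹ : T'ˣ) := by
  have hvec : ∀ j i, q'.vec j i = g (q.vec j i) := by
    intro j i
    fin_cases j <;> simp [vec, hv]
  simp only [toTuple, TangentTuple.map]
  congr 1
  · refine (X.eq_chartPoint _ _ _ _ _ fun k => ?_).symm
    rw [hx, hx, AlgHom.comp_apply, mul_left_comm, ← map_mul, chartPoint_coord_mul]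
  · funext j
    refine (X.eq_chartPoint _ _ _ _ _ fun k => ?_).symm
    -- t g(x) + ε g(v) = t (g(x) + ε t⁻¹ g(v)), and the factor t is invisible in homogeneous
    -- coordinates.
    have hy : ∀ k, q'.dualPoint j k = inl (t : T') * dualMap g (t⁻¹ : T'ˣ) (q.dualPoint j k) := by
      intro k
      refine TrivSqZeroExt.ext ?_ ?_ <;> simp [dualPoint, hx, hvec]
    rw [hy, hy, AlgHom.comp_apply, mul_left_comm, ← map_mul, chartPoint_coord_mul]

end PairPoint

end SmoothHypersurface

/-! ### The universal pair of tangent vectors, and extension of sections over the vertex -/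

namespace SmoothHypersurface

variable {d : ℕ} {X : SmoothHypersurface d} {T T' : Type} [CommRing T] [CommRing T']
  [Algebra ℂ T] [Algebra ℂ T']

/-- Evaluation at a point and a vector. -/
def TangentRing.lift (x v : Fin 5 → T) : TangentRing →ₐ[ℂ] T where
  __ := (MvPolynomial.eval₂Hom (MvPolynomial.aeval (R := ℂ) x).toRingHom v :
    MvPolynomial (Fin 5) (MvPolynomial (Fin 5) ℂ) →+* T)
  commutes' c := by
    refine (MvPolynomial.eval₂Hom_C _ _ _).trans ?_
    exact (MvPolynomial.aeval (R := ℂ) x).commutes c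

@[simp]
theorem TangentRing.lift_base (x v : Fin 5 → T) (p : MvPolynomial (Fin 5) ℂ) :
    TangentRing.lift x v (TangentRing.base p) = MvPolynomial.aeval x p :=
  MvPolynomial.eval₂Hom_C _ _ _

@[simp]
theorem TangentRing.lift_vec (x v : Fin 5 → T) (i : Fin 5) :
    TangentRing.lift x v (TangentRing.vec i) = v i :=
  MvPolynomial.eval₂Hom_X' _ _ _

theorem TangentRing.induction {motive : TangentRing → Prop}
    (base : ∀ p, motive (TangentRing.base p))
    (add : ∀ p q, motive p → motive q → motive (p + q))
    (mul_vec : ∀ p i, motive p → motive (p * TangentRing.vec i)) (p : TangentRing) : motive p :=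
  MvPolynomial.induction_on (motive := motive) p base add mul_vec

variable (X) in
theorem aeval_basePoint (p : MvPolynomial (Fin 5) ℂ) :
    MvPolynomial.aeval X.basePoint p =
      Ideal.Quotient.mk X.tangentPairIdeal (MvPolynomial.C (TangentRing.base p)) := by
  induction p using MvPolynomial.induction_on with
  | C a => rw [MvPolynomial.algHom_C]; rfl
  | add p q hp hq => rw [map_add, hp, hq, map_add, map_add, map_add]
  | mul_X p k hp => rw [map_mul, hp, MvPolynomial.aeval_X, map_mul, map_mul, map_mul]; rfl

variable (X) in
/-- The tautological pair of tangent vectors. -/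
def universalPoint : X.PairPoint X.TangentPairs where
  x := X.basePoint
  v := X.tangentVector
  aeval_F := by
    rw [X.aeval_basePoint]
    refine Ideal.Quotient.eq_zero_iff_mem.mpr (Ideal.mem_sup_left (Ideal.mem_map_of_mem _ ?_))
    exact Ideal.mem_sup_left (Ideal.mem_map_of_mem _ (Ideal.mem_span_singleton_self _))
  tangent j := by
    simp only [X.aeval_basePoint]
    fin_cases j
    · have h : MvPolynomial.C (∑ i, TangentRing.base (X.grad i) * TangentRing.vec i) ∈
          X.tangentPairIdeal :=
        Ideal.mem_sup_left (Ideal.mem_map_of_mem _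
          (Ideal.mem_sup_right (Ideal.mem_span_singleton_self _)))
      rw [← Ideal.Quotient.eq_zero_iff_mem] at h
      simpa [tangentVector] using h
    · have h : GenericDepth.linearForm (fun i => TangentRing.base (X.grad i)) ∈
          X.tangentPairIdeal := Ideal.mem_sup_right (Ideal.mem_span_singleton_self _)
      rw [← Ideal.Quotient.eq_zero_iff_mem] at h
      simpa [tangentVector, GenericDepth.linearForm] using h

namespace PairPoint

/-- Evaluation of polynomials at a pair of tangent vectors. -/
def polyHom (q : X.PairPoint T) : MvPolynomial (Fin 5) TangentRing →ₐ[ℂ] T where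
  __ := MvPolynomial.eval₂Hom (TangentRing.lift q.x (q.v 0)).toRingHom (q.v 1)
  commutes' c := by
    refine (MvPolynomial.eval₂Hom_C _ _ _).trans ?_
    exact (TangentRing.lift q.x (q.v 0)).commutes c

@[simp]
theorem polyHom_C (q : X.PairPoint T) (p : TangentRing) :
    q.polyHom (MvPolynomial.C p) = TangentRing.lift q.x (q.v 0) p :=
  MvPolynomial.eval₂Hom_C _ _ _

@[simp]
theorem polyHom_X (q : X.PairPoint T) (i : Fin 5) : q.polyHom (MvPolynomial.X i) = q.v 1 i :=
  MvPolynomial.eval₂Hom_X' _ _ _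

theorem tangentPairIdeal_le_ker (q : X.PairPoint T) :
    X.tangentPairIdeal ≤ RingHom.ker q.polyHom := by
  rw [tangentPairIdeal, tangentIdeal, Ideal.map_sup, Ideal.map_span,
    Ideal.map_span, Ideal.map_span]
  simp only [Set.image_singleton, sup_le_iff, Ideal.span_le, Set.singleton_subset_iff,
    SetLike.mem_coe, RingHom.mem_ker]
  refine ⟨⟨?_, ?_⟩, ?_⟩
  · simpa using q.aeval_F
  · simpa using q.tangent 0
  · simpa [GenericDepth.linearForm] using q.tangent 1

/-- Evaluation of functions at a pair of tangent vectors. -/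
def hom (q : X.PairPoint T) : X.TangentPairs →ₐ[ℂ] T :=
  Ideal.Quotient.liftₐ _ q.polyHom fun _ hp => q.tangentPairIdeal_le_ker hp

theorem hom_mk (q : X.PairPoint T) (p : MvPolynomial (Fin 5) TangentRing) :
    q.hom (Ideal.Quotient.mk _ p) = q.polyHom p := by
  refine (Ideal.Quotient.liftₐ_apply _ _ _ _).trans ?_
  exact Ideal.Quotient.lift_mk _ _ _

theorem universalPoint_map_hom (q : X.PairPoint T) : X.universalPoint.map q.hom = q := by
  refine PairPoint.ext (funext fun i => ?_) (funext fun j => funext fun i => ?_)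
  · refine (q.hom_mk _).trans ?_
    simp
  · fin_cases j
    · refine (q.hom_mk _).trans ?_
      simp
    · refine (q.hom_mk _).trans ?_
      simp

/-- With `universalPoint_map_hom`, this says that `TangentPairs` represents the functor of pairs of
tangent vectors. -/
theorem hom_eq (q : X.PairPoint T) (f : X.TangentPairs →ₐ[ℂ] T) (h : X.universalPoint.map f = q) :
    f = q.hom := by
  have hx : ∀ i, f (X.basePoint i) = q.x i := fun i => by rw [← h]; rfl
  have hv : ∀ j i, f (X.tangentVector j i) = q.v j i := fun j i => by rw [← h]; rfl
  have h1 : ∀ p, f (Ideal.Quotient.mk _ (MvPolynomial.C (TangentRing.base p))) =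
      MvPolynomial.aeval q.x p := fun p => by
    rw [← X.aeval_basePoint, MvPolynomial.comp_aeval_apply]
    simp only [hx]
  have h2 : ∀ p : TangentRing, f (Ideal.Quotient.mk _ (MvPolynomial.C p)) =
      TangentRing.lift q.x (q.v 0) p := by
    intro p
    induction p using TangentRing.induction with
    | base p => rw [h1, TangentRing.lift_base]
    | add p p' hp hp' => simp only [map_add, hp, hp']
    | mul_vec p i hp =>
      simp only [map_mul, hp, TangentRing.lift_vec]
      congr 1
      exact hv 0 i
  refine AlgHom.ext fun z => ?_
  obtain ⟨p, rfl⟩ := Ideal.Quotient.mk_surjective z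
  rw [hom_mk]
  induction p using MvPolynomial.induction_on with
  | C p => rw [h2, polyHom_C]
  | add p p' hp hp' => simp only [map_add, hp, hp']
  | mul_X p i hp =>
    simp only [map_mul, hp, polyHom_X]
    congr 1
    exact hv 1 i

theorem map_map {T'' : Type} [CommRing T''] [Algebra ℂ T''] (q : X.PairPoint T) (g : T →ₐ[ℂ] T')
    (g' : T' →ₐ[ℂ] T'') : (q.map g).map g' = q.map (g'.comp g) := rfl

end PairPoint

/-- The value at a pair of tangent vectors of the cone of a twisted form given on `U_i`. -/
def PairPoint.value (q : X.PairPoint T) (l : ℤ) (i : Fin 5) (h : IsUnit (q.x i))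
    (P : PolyAlg (X.Chart i) Ω[X.Chart i⁄ℂ] 3) : T :=
  (h.unit ^ l : Tˣ) * (q.toTuple i h).evalForms P

theorem PairPoint.map_value (q : X.PairPoint T) (g : T →ₐ[ℂ] T') (l : ℤ) (i : Fin 5)
    (h : IsUnit (q.x i)) (P : PolyAlg (X.Chart i) Ω[X.Chart i⁄ℂ] 3) :
    g (q.value l i h P) = (q.map g).value l i (h.map g) P := by
  have h1 : (q.map g).toTuple i (h.map g) = (q.toTuple i h).map g 1 := by
    simpa using toTuple_eq_map q (q.map g) g 1 (by simp [map]) (by simp [map]) i h (h.map g)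
  unfold value
  rw [h1, map_mul, TangentTuple.map_evalForms]
  congr 1
  have h2 : Units.map (g : T →* T') h.unit = (h.map g).unit := Units.ext rfl
  have h3 := congrArg (fun u : T'ˣ => ((u ^ l : T'ˣ) : T')) h2
  refine Eq.trans ?_ h3
  rw [← map_zpow]
  rfl

/-- The transition factor (x_j / x_i)^l between the local forms is absorbed by the normalising
powers x_i^l and x_j^l. -/
theorem PairPoint.value_eq_value {a : Fin 3 → ℕ} {l : ℤ}
    {ω : (i : Fin 5) → schur (X.Chart i) Ω[X.Chart i⁄ℂ] 3 a} (hω : ω ∈ X.globalSections a l)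
    (q : X.PairPoint T) (i j : Fin 5) (hi : IsUnit (q.x i)) (hj : IsUnit (q.x j)) :
    q.value l i hi (ω i) = q.value l j hj (ω j) := by
  have h1 := congrArg (q.toOverlapTuple i j hi hj).evalForms (hω i j)
  rw [TangentTuple.evalForms_smul, TangentTuple.evalForms_formPullback,
    TangentTuple.evalForms_formPullback, toOverlapTuple_comp_res, toOverlapTuple_comp_trans] at h1
  unfold value
  rw [h1, ← mul_assoc]
  congr 1
  let φ : X.Overlap i j →ₐ[ℂ] T := (q.toOverlapTuple i j hi hj).base
  have h2 : Units.map (φ : X.Overlap i j →* T) (X.ratio i j) * hi.unit = hj.unit :=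
    Units.ext (X.overlapPoint_ratio i j q.x q.aeval_F hi hj)
  rw [← h2, mul_zpow, mul_comm, Units.val_mul, ← map_zpow]
  rfl

variable (X) in
/-- Twisted forms that agree on overlaps are given by a function on pairs of tangent vectors. -/
theorem exists_value_eq (hd : d ≠ 0) {a : Fin 3 → ℕ} {l : ℤ}
    {ω : (i : Fin 5) → schur (X.Chart i) Ω[X.Chart i⁄ℂ] 3 a} (hω : ω ∈ X.globalSections a l) :
    ∃ s : X.TangentPairs, ∀ {T : Type} [CommRing T] [Algebra ℂ T] (q : X.PairPoint T) (i : Fin 5)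
      (h : IsUnit (q.x i)), q.hom s = q.value l i h (ω i) := by
  let B : Fin 5 → Type := fun i => Localization.Away (X.basePoint i)
  let ι : ∀ i, X.TangentPairs →ₐ[ℂ] B i := fun i =>
    IsScalarTower.toAlgHom ℂ X.TangentPairs (Localization.Away (X.basePoint i))
  have hu : ∀ i, IsUnit (ι i (X.basePoint i)) := fun i =>
    IsLocalization.Away.algebraMap_isUnit (S := Localization.Away (X.basePoint i)) (X.basePoint i)
  let f : ∀ i, B i := fun i => (X.universalPoint.map (ι i)).value l i (hu i) (ω i)
  -- Every pair with x_i invertible is induced from the universal one over D(x_i), so by naturality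
  -- f i determines all values.
  have hf : ∀ {T : Type} [CommRing T] [Algebra ℂ T] (q : X.PairPoint T) (i : Fin 5)
      (h : IsUnit (q.x i)), ∃ g : B i →ₐ[ℂ] T, (∀ b, g (ι i b) = q.hom b) ∧
        g (f i) = q.value l i h (ω i) := by
    intro T _ _ q i h
    have hx : q.hom (X.basePoint i) = q.x i :=
      congrArg (fun q' : X.PairPoint T => q'.x i) q.universalPoint_map_hom
    have hx' : IsUnit (q.hom.toRingHom (X.basePoint i)) := by
      change IsUnit (q.hom (X.basePoint i))
      rwa [hx]
    let g : B i →ₐ[ℂ] T := IsLocalization.Away.liftAlgHom (X.basePoint i) (f := q.hom) hx'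
    have hg : ∀ b, g (ι i b) = q.hom b := fun b =>
      IsLocalization.Away.lift_eq (g := q.hom.toRingHom) (X.basePoint i) hx' b
    refine ⟨g, hg, ?_⟩
    have hq : (X.universalPoint.map (ι i)).map g = q := by
      rw [PairPoint.map_map]
      have : g.comp (ι i) = q.hom := AlgHom.ext hg
      rw [this, q.universalPoint_map_hom]
    refine (PairPoint.map_value _ g l i (hu i) _).trans ?_
    congr 1
  have hsurj : ∀ i, ∃ (n : ℕ) (b : X.TangentPairs), f i * ι i (X.basePoint i) ^ n = ι i b :=
    fun i => IsLocalization.Away.surj (S := Localization.Away (X.basePoint i)) (X.basePoint i) (f i)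
  choose n b hb using hsurj
  let N := ∑ i, n i
  have hn : ∀ i, n i ≤ N := fun i =>
    Finset.single_le_sum (fun _ _ => Nat.zero_le _) (Finset.mem_univ i)
  -- Numerators of the f i over the common denominator exponent N.
  obtain ⟨b', hb'⟩ : ∃ b' : Fin 5 → X.TangentPairs,
      ∀ i, ι i (b' i) = ι i (X.basePoint i) ^ N * f i := by
    refine ⟨fun i => X.basePoint i ^ (N - n i) * b i, fun i => ?_⟩
    rw [map_mul, ← hb, map_pow, mul_left_comm, ← pow_add, Nat.sub_add_cancel (hn i), mul_comm]
  -- The values agree where x_i x_j is invertible, hence the cross-multiplied numerators agree up to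
  -- a power of x_i x_j.
  have hoverlap : ∀ i j, ∃ M, (X.basePoint i * X.basePoint j) ^ M *
      (X.basePoint j ^ N * b' i) = (X.basePoint i * X.basePoint j) ^ M *
      (X.basePoint i ^ N * b' j) := by
    intro i j
    let κ : X.TangentPairs →ₐ[ℂ] Localization.Away (X.basePoint i * X.basePoint j) :=
      IsScalarTower.toAlgHom ℂ _ _
    have hij : IsUnit (κ (X.basePoint i) * κ (X.basePoint j)) := by
      rw [← map_mul]
      exact IsLocalization.Away.algebraMap_isUnit (X.basePoint i * X.basePoint j)
    let q : X.PairPoint (Localization.Away (X.basePoint i * X.basePoint j)) :=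
      X.universalPoint.map κ
    have hq : q.hom = κ := (q.hom_eq κ rfl).symm
    have hi : IsUnit (q.x i) := isUnit_of_mul_isUnit_left hij
    have hj : IsUnit (q.x j) := isUnit_of_mul_isUnit_right hij
    have hval : ∀ k (hk : IsUnit (q.x k)),
        κ (b' k) = κ (X.basePoint k) ^ N * q.value l k hk (ω k) := by
      intro k hk
      obtain ⟨g, hg, hgf⟩ := hf q k hk
      rw [← hgf, ← hq, ← hg, ← hg, ← map_pow, ← map_mul, hb']
    have h1 : κ (X.basePoint j ^ N * b' i) = κ (X.basePoint i ^ N * b' j) := by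
      rw [map_mul, map_mul, hval i hi, hval j hj, q.value_eq_value hω i j hi hj, map_pow, map_pow]
      ring
    obtain ⟨⟨_, M, rfl⟩, hM⟩ := IsLocalization.exists_of_eq
      (M := Submonoid.powers (X.basePoint i * X.basePoint j)) h1
    exact ⟨M, hM⟩
  choose m hm using hoverlap
  let M := ∑ i, ∑ j, m i j
  have hmM : ∀ i j, m i j ≤ M := fun i j =>
    (Finset.single_le_sum (f := fun j => m i j) (fun _ _ => Nat.zero_le _)
      (Finset.mem_univ j)).trans (Finset.single_le_sum (f := fun i => ∑ j, m i j)
      (fun _ _ => Nat.zero_le _) (Finset.mem_univ i))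
  -- A uniform M absorbs those powers into the numerators, making them exactly compatible with
  -- exponent M + N.
  obtain ⟨M', s, hs⟩ := X.exists_eq_basePoint_pow_mul hd (M + N)
      (fun i => X.basePoint i ^ M * b' i) fun i j => by
    obtain ⟨k, hk⟩ := Nat.exists_eq_add_of_le (hmM i j)
    rw [hk]
    linear_combination (X.basePoint i * X.basePoint j) ^ k * hm i j
  have hfs : ∀ i, ι i s = f i := by
    intro i
    have h1 := congrArg (ι i) (hs i)
    rw [map_mul, map_mul, map_mul, hb', map_pow, map_pow, map_pow] at h1
    refine ((hu i).pow (M' + (M + N))).mul_left_cancel ?_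
    rw [← h1]
    ring
  refine ⟨s, fun q i h => ?_⟩
  obtain ⟨g, hg, hgf⟩ := hf q i h
  rw [← hgf, ← hg, hfs]

end SmoothHypersurface

/-! ### Tautological tangent vectors of a chart -/

section Tautological

open scoped DualNumber
open TrivSqZeroExt

variable (K A : Type) [CommRing K] [CommRing A] [Algebra K A] (r : ℕ)

/-- The tautological tangent vector in the `j`-th slot. -/
def tautologicalVel (j : Fin r) : A →ₐ[K] (PolyAlg A Ω[A⁄K] r)[ε] where
  toFun a := inl (algebraMap A _ a) + inr (linForm A Ω[A⁄K] r j (KaehlerDifferential.D K A a))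
  map_one' := by simp
  map_mul' a b := by
    refine TrivSqZeroExt.ext (by simp) ?_
    rw [Derivation.leibniz, map_add, map_smul, map_smul, Algebra.smul_def, Algebra.smul_def,
      DualNumber.snd_mul]
    simp only [snd_add, snd_inl, snd_inr, fst_add, fst_inl, fst_inr, zero_add, add_zero]
    ring
  map_zero' := by simp
  map_add' a b := by
    refine TrivSqZeroExt.ext (by simp) (by simp)
  commutes' c := by
    rw [← IsScalarTower.algebraMap_apply, Derivation.map_algebraMap, map_zero, inr_zero, add_zero]
    rfl

theorem snd_tautologicalVel (j : Fin r) (a : A) :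
    (tautologicalVel K A r j a).snd = linForm A Ω[A⁄K] r j (KaehlerDifferential.D K A a) := by
  simp [tautologicalVel]

end Tautological

namespace SmoothHypersurface

variable {d : ℕ} {X : SmoothHypersurface d} {T : Type} [CommRing T] [Algebra ℂ T]

theorem aeval_coord (X : SmoothHypersurface d) (i : Fin 5) (p : MvPolynomial (Fin 5) ℂ) :
    MvPolynomial.aeval (X.coord i) p = Ideal.Quotient.mk _ p := by
  induction p using MvPolynomial.induction_on with
  | C a => rw [MvPolynomial.algHom_C]; rfl
  | add p q hp hq => rw [map_add, hp, hq, map_add]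
  | mul_X p k hp => rw [map_mul, hp, MvPolynomial.aeval_X, map_mul]; rfl

theorem aeval_coord_F (X : SmoothHypersurface d) (i : Fin 5) :
    MvPolynomial.aeval (X.coord i) X.F = 0 := by
  rw [aeval_coord]
  exact Ideal.Quotient.eq_zero_iff_mem.mpr (Ideal.subset_span (by simp))

theorem coord_self (X : SmoothHypersurface d) (i : Fin 5) : X.coord i i = 1 := by
  rw [← sub_eq_zero, coord, ← map_one (Ideal.Quotient.mk _), ← map_sub]
  exact Ideal.Quotient.eq_zero_iff_mem.mpr (Ideal.subset_span (by simp))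

open scoped DualNumber in
open TrivSqZeroExt in
/-- The tautological tangent vectors of `U_i`, as tangent vectors of the cone. -/
def chartUniversalPoint (X : SmoothHypersurface d) (i : Fin 5) :
    X.PairPoint (PolyAlg (X.Chart i) Ω[X.Chart i⁄ℂ] 3) where
  x k := algebraMap (X.Chart i) _ (X.coord i k)
  v j k := linForm (X.Chart i) Ω[X.Chart i⁄ℂ] 3 (Fin.castSucc j)
    (KaehlerDifferential.D ℂ (X.Chart i) (X.coord i k))
  aeval_F := by
    have := MvPolynomial.comp_aeval_apply (X.coord i)
      (IsScalarTower.toAlgHom ℂ (X.Chart i) (PolyAlg (X.Chart i) Ω[X.Chart i⁄ℂ] 3)) X.F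
    rw [aeval_coord_F, map_zero] at this
    exact this.symm
  tangent j := by
    -- Tangency is the ε-coefficient of the relation F = 0 in the chart, transported by the
    -- tautological homomorphism.
    have h := MvPolynomial.comp_aeval_apply (X.coord i)
      (tautologicalVel ℂ (X.Chart i) 3 (Fin.castSucc j)) X.F
    rw [aeval_coord_F, map_zero] at h
    have h1 := congrArg snd (h.trans (aeval_inl_add_inr X.F _ _))
    simpa [grad] using h1.symm

theorem isUnit_chartUniversalPoint (X : SmoothHypersurface d) (i : Fin 5) :
    IsUnit ((X.chartUniversalPoint i).x i) := by
  simp [chartUniversalPoint, coord_self]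

/-- On the chart's own differentials a form evaluates to itself. The third vector is zero rather
than tautological, which is harmless in degree zero. -/
theorem evalForms_chartUniversalPoint (X : SmoothHypersurface d) (i : Fin 5) {a : Fin 3 → ℕ}
    (ha : a 2 = 0) {P : PolyAlg (X.Chart i) Ω[X.Chart i⁄ℂ] 3}
    (hP : P ∈ multiHomogeneous (X.Chart i) Ω[X.Chart i⁄ℂ] 3 a) :
    ((X.chartUniversalPoint i).toTuple i (X.isUnit_chartUniversalPoint i)).evalForms P = P := by
  refine TangentTuple.evalForms_eq_self _ (fun b => ?_) a (fun j hj b => ?_) hP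
  · refine DFunLike.congr_fun (X.eq_chartPoint i _ (X.chartUniversalPoint i).aeval_F
      (X.isUnit_chartUniversalPoint i) (IsScalarTower.toAlgHom ℂ _ _) fun k => ?_).symm b
    simp [chartUniversalPoint, coord_self]
  · rw [← snd_tautologicalVel]
    congr 1
    refine DFunLike.congr_fun (X.eq_chartPoint i _ ((X.chartUniversalPoint i).aeval_dualPoint j)
      ((X.chartUniversalPoint i).isUnit_dualPoint j (X.isUnit_chartUniversalPoint i))
      (tautologicalVel ℂ _ 3 j) fun k => ?_).symm b
    have hy : ∀ k, (X.chartUniversalPoint i).dualPoint j k =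
        tautologicalVel ℂ (X.Chart i) 3 j (X.coord i k) := by
      intro k
      fin_cases j
      · rfl
      · rfl
      · exact absurd ha hj
    rw [hy, hy, ← map_mul, coord_self, mul_one]

/-! ### Vanishing by homogeneity in the base point -/

theorem _root_.Units.pow_mul_zpow_neg_mul {R : Type} [CommRing R] (u : Rˣ) (n : ℕ) (z : R) :
    (u : R) ^ n * (((u ^ (-(n : ℤ)) : Rˣ) : R) * z) = z := by
  rw [zpow_neg, zpow_natCast, ← Units.val_pow_eq_pow_val, Units.mul_inv_cancel_left]

/-- A function on pairs of tangent vectors of the cone which restricts to twisted forms on `X` of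
degree greater than the twist vanishes. -/
theorem PairPoint.value_eq_zero {a : Fin 3 → ℕ} {l : ℤ} (hl : l < ∑ j, (a j : ℤ))
    {ω : (i : Fin 5) → schur (X.Chart i) Ω[X.Chart i⁄ℂ] 3 a} {s : X.TangentPairs}
    (hs : ∀ {T : Type} [CommRing T] [Algebra ℂ T] (q : X.PairPoint T) (i : Fin 5)
      (h : IsUnit (q.x i)), q.hom s = q.value l i h (ω i))
    (q : X.PairPoint T) (i : Fin 5) (h : IsUnit (q.x i)) : q.value l i h (ω i) = 0 := by
  -- Strict inequality makes the pole order of t ↦ s(t x, v) at least one, written m + 1.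
  obtain ⟨m, hm⟩ : ∃ m : ℕ, (∑ j, (a j : ℤ)) = l + (m + 1 : ℕ) :=
    ⟨((∑ j, (a j : ℤ)) - l - 1).toNat, by omega⟩
  let C : T →ₐ[ℂ] Polynomial T := IsScalarTower.toAlgHom ℂ T (Polynomial T)
  let ν : Polynomial T →ₐ[ℂ] LaurentPolynomial T :=
    Polynomial.toLaurentAlg.restrictScalars ℂ
  -- The pair (t x, v) over T[t]. Its coordinates need not be units there, so only the extended
  -- function s can be evaluated at it; over Laurent polynomials coordinate i becomes a unit.
  let q₁ : X.PairPoint (Polynomial T) := (q.map C).scale Polynomial.X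
  let q₂ : X.PairPoint (LaurentPolynomial T) := q₁.map ν
  let t : (LaurentPolynomial T)ˣ := ⟨LaurentPolynomial.T 1, LaurentPolynomial.T (-1),
    by rw [← LaurentPolynomial.T_add]; simp, by rw [← LaurentPolynomial.T_add]; simp⟩
  have hx : ∀ k, q₂.x k = t * (ν.comp C) (q.x k) := by
    intro k
    change ν (Polynomial.X * C (q.x k)) = _
    rw [map_mul]
    congr 1
    exact Polynomial.toLaurent_X
  have h₂ : IsUnit (q₂.x i) := by
    rw [hx]
    exact t.isUnit.mul (h.map _)
  have h1 : q₂.hom s = ν (q₁.hom s) := by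
    have : ν.comp q₁.hom = q₂.hom := by
      refine q₂.hom_eq _ ?_
      rw [← PairPoint.map_map, universalPoint_map_hom]
    rw [← this]
    rfl
  have hunit : h₂.unit = t * Units.map ((ν.comp C : T →ₐ[ℂ] LaurentPolynomial T) :
      T →* LaurentPolynomial T) h.unit := Units.ext (hx i)
  -- The twist contributes t^l and the rescaled vectors t^(-∑ a j).
  have h2 : q₂.value l i h₂ (ω i) = ((t ^ (-((m + 1 : ℕ) : ℤ)) : (LaurentPolynomial T)ˣ) :
      LaurentPolynomial T) * ν (C (q.value l i h (ω i))) := by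
    have hP : ((ω i : PolyAlg (X.Chart i) Ω[X.Chart i⁄ℂ] 3)) ∈
      multiHomogeneous (X.Chart i) Ω[X.Chart i⁄ℂ] 3 a := (ω i).2.1
    unfold value
    rw [toTuple_eq_map q q₂ (ν.comp C) t hx (fun _ _ => rfl) i h h₂,
      TangentTuple.evalForms_map_of_mem _ _ _ a hP, hunit, mul_zpow, ← map_zpow, map_mul, map_mul]
    have he : ((t⁻¹ : (LaurentPolynomial T)ˣ) : LaurentPolynomial T) ^ (∑ j, a j) =
        ((t ^ (-(∑ j, (a j : ℤ))) : (LaurentPolynomial T)ˣ) : LaurentPolynomial T) := by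
      rw [← Units.val_pow_eq_pow_val, inv_pow, zpow_neg, ← zpow_natCast]
      push_cast
      rfl
    have he' : -((m + 1 : ℕ) : ℤ) = l + -(∑ j, (a j : ℤ)) := by omega
    rw [he, he', zpow_add, Units.val_mul, Units.val_mul]
    simp only [AlgHom.comp_apply, Units.coe_map, MonoidHom.coe_coe]
    ring
  have h3 : ν (Polynomial.X ^ (m + 1) * q₁.hom s) = ν (C (q.value l i h (ω i))) := by
    have hX : ν (Polynomial.X ^ (m + 1)) = (t : LaurentPolynomial T) ^ (m + 1) :=
      (map_pow ν _ _).trans (congrArg (· ^ (m + 1)) Polynomial.toLaurent_X)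
    refine (map_mul ν _ _).trans ?_
    rw [hX]
    refine Eq.trans ?_ (Units.pow_mul_zpow_neg_mul t (m + 1) (ν (C (q.value l i h (ω i)))))
    exact congrArg _ (h1.symm.trans ((hs q₂ i h₂).trans h2))
  -- In t^(m + 1) s(t x, v) = s(x, v), an identity in T[t], the left side has no constant term.
  have h4 := congrArg (fun p => Polynomial.coeff p 0) (Polynomial.toLaurent_injective h3)
  have h5 : Polynomial.coeff (C (q.value l i h (ω i))) 0 = q.value l i h (ω i) :=
    Polynomial.coeff_C_zero
  rw [← h5]
  refine h4.symm.trans ?_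
  simp [pow_succ', mul_assoc]

end SmoothHypersurface

end

theorem propositionp4 (d : ℕ) (hd : 2 ≤ d) (X : SmoothHypersurface d) (b₁ b₂ : ℕ)
    (hb₂ : 1 ≤ b₂) (hb : b₂ ≤ b₁) (l : ℤ) (hl : l < b₁ + b₂) :
    X.globalSections ![b₁, b₂, 0] l = ⊥ := by
  rw [eq_bot_iff]
  intro ω hω
  obtain ⟨s, hs⟩ := X.exists_value_eq (by omega) hω
  refine AddSubgroup.mem_bot.mpr (funext fun i => Subtype.ext ?_)
  have h1 := SmoothHypersurface.PairPoint.value_eq_zero (by simpa [Fin.sum_univ_three] using hl) hs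
    (X.chartUniversalPoint i) i (X.isUnit_chartUniversalPoint i)
  have h2 := X.evalForms_chartUniversalPoint i (a := ![b₁, b₂, 0]) rfl (ω i).2.1
  rw [SmoothHypersurface.PairPoint.value, h2] at h1
  exact (Units.mul_right_eq_zero _).mp h1
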